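/- **Setting.** Let $n$ workers and a server minimize $f=\frac1n\sum_{i=1}^n f_i$ over $\mathbb R^d$. *Functions.* $\{f_i\}\subseteq\mathcal F_{\Delta,L}$ means that each $f_i$ is differentiable with $L$-Lipschitz gradient and that $f$ is bounded below with $f(x^{(0)})-\inf f\le\Delta$, where $x^{(0)}=0$ is the initial point. *Oracles.* A stochastic oracle $O_i(x;\zeta_i)$, with a random seed $\zeta_i$, is in the class $\mathcal O_{\sigma^2}$ for $f_i$ if $\mathbb E[O_i(x;\zeta_i)]=\nabla f_i(x)$ and $\mathbb E\|O_i(x;\zeta_i)-\nabla f_i(x)\|^2\le\sigma^2$ for all $x$. All queries of all workers use independent seeds. *Compressors.* A random map $C_i:\mathbb R^d\to\mathbb R^d$ is an $\omega$-unbiased compressor if $\mathbb E[C_i(x)]=x$ and $\mathbb E\|C_i(x)-x\|^2\le\omega\|x\|^2$ for all $x$. Different rounds of communication use independent randomness (independent also of the oracles); within one round the compressors of different workers may be dependent. *Algorithms.* A centralized synchronous algorithm with unidirectional compression (server compressor $C_0=I$), started at $x_i^{(0)}=0$, runs for iterations $t=1,\dots,T$. In iteration $t$ every worker $i$ queries its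 oracle at a point $y_i^{(t)}$ and receives $g_i^{(t)}=O_i(y_i^{(t)};\zeta_i^{(t)})$; then there are finitely many (possibly zero) synchronous rounds of communication, in each of which every worker $i$ sends a vector $v$, the server receives $C_i(v)$, and the server broadcasts a vector to all workers without compression; then every worker $i$ forms a local model $x_i^{(t)}$. The total number of rounds is at most $T$. The vectors sent by the workers in iteration $t$ and the number of rounds in iteration $t$ are chosen before the compression in that iteration. The algorithm may be adaptive and randomized, but every choice is independent of the oracle and compressor randomness not yet drawn. The output $\hat x$ is any linear combination, with possibly random coefficients, of the local models $x_i^{(s)}$, $0\le s\le T$, $1\le i\le n$. The algorithm is *zero-respecting* if, almost surely, for all $1\le t\le T$, all $i$ and all coordinates $k$: 1. $[y_i^{(t)}]_k\ne0$ only if coordinate $k$ is non-zero in some $x_i^{(s)}$ with $0\le s<t$, or in some $g_i^{(s)}$, some vector broadcast in iteration $s$, or some compressed message of worker $i$ of iteration $s$, with $1\le s<t$. 2. $[x_i^{(t)}]_k\ne0$ only if coordinate $k$ is non-zero in some $x_i^{(s)}$ with $0\le s<t$, or in some $g_i^{(s)}$, some vector broadcast in iteration $s$, or some compressed message of worker $i$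 of iteration $s$, with $1\le s\le t$. 3. Worker $i$ sends in iteration $t$ a vector with non-zero $k$-th coordinate only if coordinate $k$ is non-zero in some $x_i^{(s)}$ with $0\le s<t$, or in some $g_i^{(s)}$ with $1\le s\le t$, or in some vector broadcast in iteration $s$ or some compressed message of worker $i$ of iteration $s$, with $1\le s<t$. 4. The server broadcasts in iteration $t$ a vector with non-zero $k$-th coordinate only if coordinate $k$ is non-zero in some compressed message received from some worker in an iteration $s$ with $1\le s\le t$, or in some vector broadcast in an iteration $s$ with $1\le s<t$. **Theorem.** There is a universal constant $c>0$ such that for all $\Delta,L>0$, all integers $n\ge2$, all $\omega\ge0$, $\sigma>0$, and all integers $T\ge(1+\omega)^2$, there exist a dimension $d\ge1$, local functions $\{f_i\}_{i=1}^n\subseteq\mathcal F_{\Delta,L}$ on $\mathbb R^d$, stochastic gradient oracles $\{O_i\}_{i=1}^n\subseteq\mathcal O_{\sigma^2}$ and $\omega$-unbiased compressors $\{C_i\}_{i=1}^n$ (with $C_0=I$), such that the output $\hat x$ of every zero-respecting centralized algorithm with unidirectional compression, started at $x^{(0)}=0$ and using $T$ gradient queries per worker and at most $T$ rounds of communication,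 satisfies $$\mathbb E\|\nabla f(\hat x)\|^2\;\ge\;c\left(\min\left\{\Delta L,\ \left(\frac{\Delta L\sigma^2}{nT}\right)^{1/2}\right\}+\frac{(1+\omega)\Delta L}{T}\right).$$ In particular, $\mathbb E\|\nabla f(\hat x)\|^2=\Omega\big((\frac{\Delta L\sigma^2}{nT})^{1/2}+\frac{(1+\omega)\Delta L}{T}\big)$ as soon as $T\ge\sigma^2/(n\Delta L)$. -/

import Mathlib

open MeasureTheory ProbabilityTheory
open scoped Gradient

/-- The parameter space `ℝ^d` with its Euclidean norm. -/
abbrev Vec (d : ℕ) : Type := EuclideanSpace ℝ (Fin d)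

/-- The global objective `f = (1/n) ∑ f_i`. -/
noncomputable def globalObjective {n d : ℕ} (f : Fin n → Vec d → ℝ) (x : Vec d) : ℝ :=
  (n : ℝ)⁻¹ * ∑ i, f i x

/-- The function class `ℱ_{Δ,L}` for the initial point `x₀`: every local objective is differentiable
with `L`-Lipschitz gradient, and the average `f` is bounded below with `f(x₀) - inf f ≤ Δ`. -/
structure InFunctionClass {n d : ℕ} (Δ L : ℝ) (x₀ : Vec d) (f : Fin n → Vec d → ℝ) : Prop where
  differentiable : ∀ i, Differentiable ℝ (f i)
  smooth : ∀ i x y, ‖∇ (f i) x - ∇ (f i) y‖ ≤ L * ‖x - y‖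
  bddBelow : BddBelow (Set.range (globalObjective f))
  gap : globalObjective f x₀ - ⨅ x, globalObjective f x ≤ Δ

/-- A stochastic gradient oracle `O(x; ζ)` on `ℝ^d`, with random seed `ζ` of law `law`. -/
structure StochasticOracle (d : ℕ) where
  Seed : Type
  [seedSpace : MeasurableSpace Seed]
  law : Measure Seed
  [isProb : IsProbabilityMeasure law]
  eval : Seed → Vec d → Vec d
  measurable_eval : Measurable (Function.uncurry eval)

attribute [instance] StochasticOracle.seedSpace StochasticOracle.isProb

/-- The oracle is an unbiased estimator of `∇ f` with variance at most `σ²`, at every point. -/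
structure StochasticOracle.InClass {d : ℕ} (O : StochasticOracle d) (f : Vec d → ℝ) (σ : ℝ) :
    Prop where
  integrable : ∀ x, Integrable (fun z => O.eval z x) O.law
  unbiased : ∀ x, ∫ z, O.eval z x ∂O.law = ∇ f x
  integrable_sq : ∀ x, Integrable (fun z => ‖O.eval z x - ∇ f x‖ ^ 2) O.law
  variance_le : ∀ x, ∫ z, ‖O.eval z x - ∇ f x‖ ^ 2 ∂O.law ≤ σ ^ 2

/-- Random compressors `C_1, …, C_n` on `ℝ^d` of the `n` workers. In one round of communication they
read one common seed, so that their joint law is arbitrary: they may be independent (put the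
product of `n` seed spaces) or share their randomness. -/
structure WorkerCompressors (n d : ℕ) where
  Seed : Type
  [seedSpace : MeasurableSpace Seed]
  law : Measure Seed
  [isProb : IsProbabilityMeasure law]
  compress : Fin n → Seed → Vec d → Vec d
  measurable_compress : ∀ i, Measurable (Function.uncurry (compress i))

attribute [instance] WorkerCompressors.seedSpace WorkerCompressors.isProb

/-- Every worker compressor is `ω`-unbiased:
`𝔼 C_i(x) = x` and `𝔼 ‖C_i(x) - x‖² ≤ ω ‖x‖²` for every `x`. -/
structure WorkerCompressors.IsUnbiased {n d : ℕ} (C : WorkerCompressors n d) (ω : ℝ) : Prop where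
  integrable : ∀ i x, Integrable (fun s => C.compress i s x) C.law
  unbiased : ∀ i x, ∫ s, C.compress i s x ∂C.law = x
  integrable_sq : ∀ i x, Integrable (fun s => ‖C.compress i s x - x‖ ^ 2) C.law
  variance_le : ∀ i x, ∫ s, ‖C.compress i s x - x‖ ^ 2 ∂C.law ≤ ω * ‖x‖ ^ 2

/-- An execution, on a probability space `(Ω, P)`, of a centralized synchronous algorithm with
unidirectional compression, started at `x₀`, with `T` gradient queries per worker and at most `T`
synchronous rounds of communication.

It has iterations `t = 1, …, T`. In iteration `t`, each worker `i` queries its oracle at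
`query t i`; then there are `rounds t` rounds of communication (possibly none), where in round `j`
each worker `i` sends `message t i j` through its compressor to the server (a worker with nothing to
send sends `0`) and the server broadcasts `broadcast t j`, uncompressed (`C_0 = I`); finally each
worker `i` produces its local model `model t i`.

The algorithm may be adaptive and randomized, but it cannot foresee the randomness of the oracles
and the compressors: `before t` is the information available at the start of iteration `t`
(which may include private coin flips), and `between t` is the information available after the
queries of iteration `t`, before the compression of the messages. The seeds drawn next are
independent of that information. -/
structure Execution {n d : ℕ} (O : Fin n → StochasticOracle d) (C : WorkerCompressors n d) (T : ℕ)
    (x₀ : Vec d) {Ω : Type*} [mΩ : MeasurableSpace Ω] (P : Measure Ω) where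
  before : ℕ → MeasurableSpace Ω
  between : ℕ → MeasurableSpace Ω
  before_le : ∀ t, before t ≤ between t
  between_le : ∀ t, between t ≤ before (t + 1)
  le_ambient : ∀ t, before t ≤ mΩ
  /-- `oracleSeed t w i` is the seed of the `t`-th query of worker `i`. -/
  oracleSeed : ℕ → Ω → (i : Fin n) → (O i).Seed
  /-- `roundSeed t w j` is the seed of the compressors in round `j` of iteration `t`. -/
  roundSeed : ℕ → Ω → Fin T → C.Seed
  query : ℕ → Fin n → Ω → Vec d
  rounds : ℕ → Ω → ℕ
  message : ℕ → Fin n → Fin T → Ω → Vec d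
  broadcast : ℕ → Fin T → Ω → Vec d
  model : ℕ → Fin n → Ω → Vec d
  model_zero : ∀ i w, model 0 i w = x₀
  rounds_le : ∀ w, ∑ t ∈ Finset.Icc 1 T, rounds t w ≤ T
  measurable_query : ∀ t ∈ Finset.Icc 1 T, ∀ i, Measurable[before t] (query t i)
  measurable_oracleSeed : ∀ t ∈ Finset.Icc 1 T, Measurable[between t] (oracleSeed t)
  law_oracleSeed : ∀ t ∈ Finset.Icc 1 T, P.map (oracleSeed t) = Measure.pi fun i => (O i).law
  indep_oracleSeed : ∀ t ∈ Finset.Icc 1 T,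
    Indep (MeasurableSpace.comap (oracleSeed t) inferInstance) (before t) P
  measurable_rounds : ∀ t ∈ Finset.Icc 1 T, Measurable[between t] (rounds t)
  measurable_message : ∀ t ∈ Finset.Icc 1 T, ∀ i j, Measurable[between t] (message t i j)
  measurable_roundSeed : ∀ t ∈ Finset.Icc 1 T, Measurable[before (t + 1)] (roundSeed t)
  law_roundSeed : ∀ t ∈ Finset.Icc 1 T, P.map (roundSeed t) = Measure.pi fun _ => C.law
  indep_roundSeed : ∀ t ∈ Finset.Icc 1 T,
    Indep (MeasurableSpace.comap (roundSeed t) inferInstance) (between t) P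
  measurable_broadcast : ∀ t ∈ Finset.Icc 1 T, ∀ j, Measurable[before (t + 1)] (broadcast t j)
  measurable_model : ∀ t ∈ Finset.Icc 1 T, ∀ i, Measurable[before (t + 1)] (model t i)

namespace Execution

variable {n d : ℕ} {O : Fin n → StochasticOracle d} {C : WorkerCompressors n d} {T : ℕ}
  {x₀ : Vec d} {Ω : Type*} [MeasurableSpace Ω] {P : Measure Ω}

/-- The answer `O_i(y_i^{(t)}; ζ_i^{(t)})` to the `t`-th query of worker `i`. -/
def answer (A : Execution O C T x₀ P) (t : ℕ) (i : Fin n) (w : Ω) : Vec d :=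
  (O i).eval (A.oracleSeed t w i) (A.query t i w)

/-- The compressed message that the server receives from worker `i` in round `j` of iteration `t`. -/
def received (A : Execution O C T x₀ P) (t : ℕ) (i : Fin n) (j : Fin T) (w : Ω) : Vec d :=
  C.compress i (A.roundSeed t w j) (A.message t i j w)

/-- Coordinate `k` is non-zero in a local model of worker `i` of an iteration in `[0, a)`, or in an
oracle answer of an iteration in `[1, b)`, or in a broadcast or a compressed own message of an
iteration in `[1, c)`. -/
def WorkerHas (A : Execution O C T x₀ P) (a b c : ℕ) (i : Fin n) (k : Fin d) (w : Ω) : Prop :=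
  (∃ s, s < a ∧ A.model s i w k ≠ 0) ∨
  (∃ s, 1 ≤ s ∧ s < b ∧ A.answer s i w k ≠ 0) ∨
  (∃ s, 1 ≤ s ∧ s < c ∧ ∃ j : Fin T, (j : ℕ) < A.rounds s w ∧ A.broadcast s j w k ≠ 0) ∨
  (∃ s, 1 ≤ s ∧ s < c ∧ ∃ j : Fin T, (j : ℕ) < A.rounds s w ∧ A.received s i j w k ≠ 0)

/-- Coordinate `k` is non-zero in a message that the server received, from any worker, in an
iteration in `[1, t]`, or in a vector that it broadcast in an iteration in `[1, t)`. -/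
def ServerHas (A : Execution O C T x₀ P) (t : ℕ) (k : Fin d) (w : Ω) : Prop :=
  (∃ s, 1 ≤ s ∧ s ≤ t ∧ ∃ (i : Fin n) (j : Fin T),
    (j : ℕ) < A.rounds s w ∧ A.received s i j w k ≠ 0) ∨
  (∃ s, 1 ≤ s ∧ s < t ∧ ∃ j : Fin T, (j : ℕ) < A.rounds s w ∧ A.broadcast s j w k ≠ 0)

/-- The zero-respecting property, for almost every outcome: non-zero coordinates of the queries,
local models, messages and broadcasts only arise from earlier local models, oracle answers and
communicated vectors. -/
structure ZeroRespecting (A : Execution O C T x₀ P) : Prop where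
  query : ∀ᵐ w ∂P, ∀ t ∈ Finset.Icc 1 T, ∀ i k,
    A.query t i w k ≠ 0 → A.WorkerHas t t t i k w
  model : ∀ᵐ w ∂P, ∀ t ∈ Finset.Icc 1 T, ∀ i k,
    A.model t i w k ≠ 0 → A.WorkerHas t (t + 1) (t + 1) i k w
  message : ∀ᵐ w ∂P, ∀ t ∈ Finset.Icc 1 T, ∀ i (j : Fin T) k, (j : ℕ) < A.rounds t w →
    A.message t i j w k ≠ 0 → A.WorkerHas t (t + 1) t i k w
  broadcast : ∀ᵐ w ∂P, ∀ t ∈ Finset.Icc 1 T, ∀ (j : Fin T) k, (j : ℕ) < A.rounds t w →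
    A.broadcast t j w k ≠ 0 → A.ServerHas t k w

/-- `xhat` is a possible output after `T` iterations: a random vector that is almost surely a linear
combination (with possibly random coefficients) of the local models of all workers. -/
structure IsOutput (A : Execution O C T x₀ P) (xhat : Ω → Vec d) : Prop where
  measurable : Measurable xhat
  mem_span : ∀ᵐ w ∂P,
    xhat w ∈ Submodule.span ℝ {v | ∃ s ≤ T, ∃ i : Fin n, v = A.model s i w}

end Execution

/-! The two terms of the bound come from two separate hard instances. Since a sum is at most twice
the larger term, the instance for the larger term suffices.

Both instances use a rescaled chain on M + 1 coordinates. Link k rewards increasing x_k, but through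
a gate that opens only when x_{k-1} > 0. Hence at a point supported on the first a coordinates the
gradient involves at most coordinate a (counting from 0) in addition. Conversely, while any
coordinate is zero the gradient has norm at least a constant (`norm_chainGrad_ge`). The chain has a
gradient with constant Lipschitz modulus and a gap of order M + 1. After scaling to Δ and L, the
squared gradient at an unfinished point is therefore of order ΔL/(M + 1). It remains to make M as
small as possible while progress along the chain is still too rare to finish it.

Noise: all workers hold the whole chain, and the oracle hides the newly reached coordinate unless a
coin of bias p falls true. The variance allows p of order ΔL/(M σ²). At most nTp iterations advance
on average, so M of order √(nTΔL/σ²) suffices.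

Compression: workers of even and odd index hold the even and odd links. Alone, a worker gets at most
one coordinate beyond what the server has passed on; further progress needs a message of a worker of
the other parity. One common coin of bias 1/(1 + ω) lets all messages of a round pass or drops them
all. Messages are fixed before the compression of their iteration, so an iteration gains at most one
coordinate. At most T/(1 + ω) iterations advance on average, so M of order T/(1 + ω) suffices.

In both cases supports are tracked deterministically by a count of good events
(`Execution.supportedBelow_model`), and Markov's inequality bounds that count with probability 1/2
(`le_lintegral_of_output`). Linearity of expectation is enough: adaptivity matters only for the
number of rounds, which is independent of the coins drawn afterwards. -/

/-! ### The scalar building blocks of the chain -/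

/-- A `C^{1,1}` gate: it vanishes on `(-∞, 0]`, and it is at least `1/2` on `[1, ∞)`. -/
noncomputable def gate (x : ℝ) : ℝ := (max x 0) ^ 2 / (1 + (max x 0) ^ 2)

noncomputable def gateDeriv (x : ℝ) : ℝ := 2 * max x 0 / (1 + (max x 0) ^ 2) ^ 2

/-- A bounded increasing function. -/
noncomputable def ramp (x : ℝ) : ℝ := Real.arctan x + Real.pi / 2

noncomputable def rampDeriv (x : ℝ) : ℝ := 1 / (1 + x ^ 2)

theorem hasDerivAt_max_sq (x : ℝ) : HasDerivAt (fun x : ℝ => (max x 0) ^ 2) (2 * max x 0) x := by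
  rcases lt_trichotomy x 0 with h | rfl | h
  · rw [max_eq_right h.le, mul_zero]
    refine (hasDerivAt_const x (0 : ℝ)).congr_of_eventuallyEq ?_
    filter_upwards [gt_mem_nhds h] with y hy
    rw [max_eq_right hy.le]; norm_num
  · have h : HasFDerivAt (fun x : ℝ => (max x 0) ^ 2) (0 : ℝ →L[ℝ] ℝ) 0 := by
      refine Asymptotics.IsBigO.hasFDerivAt (n := 2) ?_ (by norm_num)
      refine Asymptotics.IsBigO.of_bound 1 (Filter.Eventually.of_forall fun y => ?_)
      rw [sub_zero, norm_pow, norm_pow, norm_norm, one_mul]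
      have : ‖max y 0‖ ≤ ‖y‖ := by
        rw [Real.norm_of_nonneg (le_max_right _ _)]
        exact max_le (le_abs_self y) (abs_nonneg y)
      gcongr
    simpa using h.hasDerivAt
  · rw [max_eq_left h.le]
    have h2 : HasDerivAt (fun x : ℝ => x ^ 2) (2 * x) x := by simpa using hasDerivAt_pow 2 x
    refine h2.congr_of_eventuallyEq ?_
    filter_upwards [lt_mem_nhds h] with y hy
    rw [max_eq_left hy.le]

theorem hasDerivAt_min_sq (x : ℝ) : HasDerivAt (fun x : ℝ => (min x 0) ^ 2 / 2) (min x 0) x := by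
  have h := ((hasDerivAt_max_sq (-x)).comp x (hasDerivAt_neg x)).div_const 2
  have e : ∀ y : ℝ, max (-y) 0 = - min y 0 := fun y => by
    rw [← neg_zero, max_neg_neg, neg_zero]
  have hf : (fun x : ℝ => (min x 0) ^ 2 / 2) =
      fun x => ((fun x : ℝ => (max x 0) ^ 2) ∘ Neg.neg) x / 2 := by
    funext y; simp [e]
  rw [hf]
  exact h.congr_deriv (by rw [e]; ring)

theorem hasDerivAt_gate (x : ℝ) : HasDerivAt gate (gateDeriv x) x := by
  have h := hasDerivAt_max_sq x
  have h1 : (1 : ℝ) + (max x 0) ^ 2 ≠ 0 := by positivity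
  refine (h.div (h.const_add 1) h1).congr_deriv ?_
  unfold gateDeriv
  congr 1
  ring

theorem hasDerivAt_ramp (x : ℝ) : HasDerivAt ramp (rampDeriv x) x :=
  (Real.hasDerivAt_arctan x).add_const _

theorem gate_nonneg (x : ℝ) : 0 ≤ gate x := by unfold gate; positivity

theorem gate_le_one (x : ℝ) : gate x ≤ 1 := by
  unfold gate
  rw [div_le_one (by positivity)]
  linarith

theorem half_le_gate {x : ℝ} (hx : 1 ≤ x) : 1 / 2 ≤ gate x := by
  unfold gate
  rw [max_eq_left (by linarith), div_le_div_iff₀ (by norm_num) (by positivity)]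
  nlinarith

@[simp] theorem gate_zero : gate 0 = 0 := by simp [gate]

@[simp] theorem gateDeriv_zero : gateDeriv 0 = 0 := by simp [gateDeriv]

theorem gateDeriv_nonneg (x : ℝ) : 0 ≤ gateDeriv x := by unfold gateDeriv; positivity

theorem gateDeriv_le_one (x : ℝ) : gateDeriv x ≤ 1 := by
  unfold gateDeriv
  rw [div_le_one (by positivity)]
  nlinarith [sq_nonneg (max x 0 - 1), sq_nonneg (max x 0)]

theorem ramp_nonneg (x : ℝ) : 0 ≤ ramp x := by
  have := Real.neg_pi_div_two_lt_arctan x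
  unfold ramp; linarith

theorem ramp_le_four (x : ℝ) : ramp x ≤ 4 := by
  have := Real.arctan_lt_pi_div_two x
  have := Real.pi_le_four
  unfold ramp; linarith

theorem rampDeriv_nonneg (x : ℝ) : 0 ≤ rampDeriv x := by unfold rampDeriv; positivity

theorem rampDeriv_le_one (x : ℝ) : rampDeriv x ≤ 1 := by
  unfold rampDeriv
  rw [div_le_one (by positivity)]
  nlinarith [sq_nonneg x]

theorem half_le_rampDeriv {x : ℝ} (h₁ : -1 ≤ x) (h₂ : x ≤ 1) : 1 / 2 ≤ rampDeriv x := by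
  unfold rampDeriv
  rw [div_le_div_iff₀ (by norm_num) (by positivity)]
  nlinarith

theorem abs_sub_le_of_hasDerivAt {f f' : ℝ → ℝ} {K : ℝ} (hf : ∀ x, HasDerivAt f (f' x) x)
    (hK : ∀ x, |f' x| ≤ K) (x y : ℝ) : |f x - f y| ≤ K * |x - y| :=
  convex_univ.norm_image_sub_le_of_norm_hasDerivWithin_le
    (fun z _ => (hf z).hasDerivWithinAt) (fun z _ => hK z) (Set.mem_univ y) (Set.mem_univ x)

theorem abs_gate_sub_le (x y : ℝ) : |gate x - gate y| ≤ |x - y| := by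
  simpa using abs_sub_le_of_hasDerivAt (K := 1) hasDerivAt_gate
    (fun z => by rw [abs_of_nonneg (gateDeriv_nonneg z)]; exact gateDeriv_le_one z) x y

theorem abs_ramp_sub_le (x y : ℝ) : |ramp x - ramp y| ≤ |x - y| := by
  simpa using abs_sub_le_of_hasDerivAt (K := 1) hasDerivAt_ramp
    (fun z => by rw [abs_of_nonneg (rampDeriv_nonneg z)]; exact rampDeriv_le_one z) x y

theorem abs_rampDeriv_sub_le (x y : ℝ) : |rampDeriv x - rampDeriv y| ≤ |x - y| := by
  have e : rampDeriv x - rampDeriv y = (y - x) * ((x + y) / ((1 + x ^ 2) * (1 + y ^ 2))) := by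
    unfold rampDeriv
    field_simp
    ring
  have h : |(x + y) / ((1 + x ^ 2) * (1 + y ^ 2))| ≤ 1 := by
    rw [abs_div, abs_of_pos (by positivity : 0 < (1 + x ^ 2) * (1 + y ^ 2)),
      div_le_one (by positivity), abs_le]
    constructor <;> nlinarith [sq_nonneg (x - 1), sq_nonneg (y - 1), sq_nonneg (x + 1),
      sq_nonneg (y + 1), sq_nonneg (x * y)]
  rw [e, abs_mul, abs_sub_comm]
  exact mul_le_of_le_one_right (abs_nonneg _) h

theorem abs_gateDeriv_sub_le (x y : ℝ) : |gateDeriv x - gateDeriv y| ≤ 2 * |x - y| := by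
  unfold gateDeriv
  have hm : |max x 0 - max y 0| ≤ |x - y| := abs_max_sub_max_le_abs x y 0
  generalize max x 0 = a, max y 0 = b, le_max_right x 0 = ha, le_max_right y 0 = hb at *
  have e : 2 * a / (1 + a ^ 2) ^ 2 - 2 * b / (1 + b ^ 2) ^ 2 = 2 * ((a - b) *
      ((1 - 2 * a * b - a * b * (a ^ 2 + a * b + b ^ 2)) /
        ((1 + a ^ 2) ^ 2 * (1 + b ^ 2) ^ 2))) := by
    field_simp
    ring
  have h : |(1 - 2 * a * b - a * b * (a ^ 2 + a * b + b ^ 2)) /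
      ((1 + a ^ 2) ^ 2 * (1 + b ^ 2) ^ 2)| ≤ 1 := by
    have hab : 0 ≤ a * b := mul_nonneg ha hb
    have hn : |1 - 2 * a * b - a * b * (a ^ 2 + a * b + b ^ 2)| ≤
        1 + 2 * (a * b) + a * b * (a ^ 2 + a * b + b ^ 2) := by
      have : 0 ≤ a * b * (a ^ 2 + a * b + b ^ 2) := by positivity
      rw [abs_le]
      constructor <;> nlinarith
    -- With s = a² + b² ≥ 2ab, the left side is at most 1 + s + (3/4)s², which is below (1 + s)².
    have hd : 1 + 2 * (a * b) + a * b * (a ^ 2 + a * b + b ^ 2) ≤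
        (1 + a ^ 2) ^ 2 * (1 + b ^ 2) ^ 2 := by
      have e2 : (1 + a ^ 2) ^ 2 * (1 + b ^ 2) ^ 2 = (1 + (a ^ 2 + b ^ 2) + (a * b) ^ 2) ^ 2 := by
        ring
      have h1 : 2 * (a * b) ≤ a ^ 2 + b ^ 2 := by nlinarith [sq_nonneg (a - b)]
      rw [e2]
      generalize a ^ 2 + b ^ 2 = s at *
      have e3 : a ^ 2 + a * b + b ^ 2 = (a ^ 2 + b ^ 2) + a * b := by ring
      nlinarith [sq_nonneg (a - b), mul_nonneg hab hab, sq_nonneg (a * b), sq_nonneg (a + b),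
        mul_nonneg hab (sq_nonneg (a - b)), sq_nonneg (a ^ 2 - b ^ 2)]
    rw [abs_div, abs_of_pos (by positivity : 0 < (1 + a ^ 2) ^ 2 * (1 + b ^ 2) ^ 2),
      div_le_one (by positivity)]
    exact hn.trans hd
  rw [e, abs_mul, abs_mul, abs_two]
  have := mul_le_of_le_one_right (abs_nonneg (a - b)) h
  linarith

theorem abs_min_sub_le (x y : ℝ) : |min x 0 - min y 0| ≤ |x - y| := by
  have h := abs_min_sub_min_le_max x 0 y 0
  simpa using h

/-! ### The chain -/

section Chain

variable {M : ℕ}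

/-- The gate in front of link `k`: always open for the first link. -/
noncomputable def linkGate (x : Vec (M + 1)) : Fin (M + 1) → ℝ :=
  Fin.cons 1 fun k : Fin M => gate (x k.castSucc)

/-- The weighted value of the ramp that link `k + 1` puts behind the gate of coordinate `k`. -/
noncomputable def nextRamp (w : ℕ → ℝ) (x : Vec (M + 1)) : Fin (M + 1) → ℝ :=
  Fin.snoc (fun k : Fin M => w (k + 1) * ramp (x k.succ)) 0

/-- The weighted chain: link `k` has weight `w k` and can only be descended along when coordinate
`k - 1` is positive. -/
noncomputable def chain (w : ℕ → ℝ) (x : Vec (M + 1)) : ℝ :=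
  ∑ k : Fin (M + 1), (-(w k * linkGate x k * ramp (x k)) + (min (x k) 0) ^ 2 / 2)

noncomputable def chainGrad (w : ℕ → ℝ) (x : Vec (M + 1)) : Vec (M + 1) :=
  WithLp.toLp 2 fun k =>
    -(w k * linkGate x k * rampDeriv (x k)) - gateDeriv (x k) * nextRamp w x k + min (x k) 0

theorem chainGrad_apply (w : ℕ → ℝ) (x : Vec (M + 1)) (k : Fin (M + 1)) :
    chainGrad w x k = -(w k * linkGate x k * rampDeriv (x k)) -
      gateDeriv (x k) * nextRamp w x k + min (x k) 0 := rfl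

theorem linkGate_nonneg (x : Vec (M + 1)) (k : Fin (M + 1)) : 0 ≤ linkGate x k := by
  refine Fin.cases ?_ (fun k => ?_) k
  · simp [linkGate]
  · simpa [linkGate] using gate_nonneg _

theorem linkGate_le_one (x : Vec (M + 1)) (k : Fin (M + 1)) : linkGate x k ≤ 1 := by
  refine Fin.cases ?_ (fun k => ?_) k
  · simp [linkGate]
  · simpa [linkGate] using gate_le_one _

theorem nextRamp_nonneg {w : ℕ → ℝ} (hw : ∀ k, 0 ≤ w k) (x : Vec (M + 1)) (k : Fin (M + 1)) :
    0 ≤ nextRamp w x k := by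
  refine Fin.lastCases ?_ (fun k => ?_) k
  · simp [nextRamp]
  · simpa [nextRamp] using mul_nonneg (hw _) (ramp_nonneg _)

theorem nextRamp_le_four {w : ℕ → ℝ} (hw : ∀ k, w k ≤ 1) (x : Vec (M + 1))
    (k : Fin (M + 1)) : nextRamp w x k ≤ 4 := by
  refine Fin.lastCases ?_ (fun k => ?_) k
  · simp [nextRamp]
  · have := mul_le_mul_of_nonneg_right (hw (k + 1)) (ramp_nonneg (x k.succ))
    have := ramp_le_four (x k.succ)
    simp only [nextRamp, Fin.snoc_castSucc]
    linarith

theorem hasGradientAt_chain (w : ℕ → ℝ) (x : Vec (M + 1)) :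
    HasGradientAt (chain w) (chainGrad w x) x := by
  rw [hasGradientAt_iff_hasFDerivAt]
  have hx (k : Fin (M + 1)) : HasFDerivAt (fun y : Vec (M + 1) => y k)
      (EuclideanSpace.proj k : Vec (M + 1) →L[ℝ] ℝ) x :=
    (EuclideanSpace.proj k : Vec (M + 1) →L[ℝ] ℝ).hasFDerivAt
  have hg (k : Fin (M + 1)) : HasFDerivAt (fun y : Vec (M + 1) => linkGate y k)
      (Fin.cons (α := fun _ => Vec (M + 1) →L[ℝ] ℝ) 0 (fun k : Fin M => gateDeriv (x k.castSucc) •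
        (EuclideanSpace.proj k.castSucc : Vec (M + 1) →L[ℝ] ℝ)) k) x := by
    refine Fin.cases ?_ (fun k => ?_) k
    · simpa [linkGate] using hasFDerivAt_const (1 : ℝ) x
    · exact (hasDerivAt_gate _).comp_hasFDerivAt x (hx k.castSucc)
  have hr (k : Fin (M + 1)) := (hasDerivAt_ramp _).comp_hasFDerivAt x (hx k)
  have hm (k : Fin (M + 1)) := (hasDerivAt_min_sq _).comp_hasFDerivAt x (hx k)
  have h := HasFDerivAt.fun_sum (u := Finset.univ) fun (k : Fin (M + 1)) _ =>
    ((((hg k).const_mul (w k)).mul (hr k)).neg.add (hm k))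
  refine h.congr_fderiv ?_
  ext v
  simp only [chainGrad, InnerProductSpace.toDual_apply_apply, PiLp.inner_apply]
  -- Index shift: differentiating the gate of link k + 1 contributes to coordinate k. The first link
  -- has a constant gate and the last coordinate has no successor, so the boundary terms on both
  -- sides vanish.
  have hs : ∑ k : Fin (M + 1), nextRamp w x k * gateDeriv (x k) * v k =
      ∑ k : Fin (M + 1), w k * ramp (x k) * (Fin.cons (α := fun _ => Vec (M + 1) →L[ℝ] ℝ) 0
        (fun k : Fin M => gateDeriv (x k.castSucc) •
        (EuclideanSpace.proj k.castSucc : Vec (M + 1) →L[ℝ] ℝ)) k) v := by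
    rw [Fin.sum_univ_castSucc, Fin.sum_univ_succ]
    simp [nextRamp, mul_assoc]
  have e (k : Fin (M + 1)) : v k * (-(w k * linkGate x k * rampDeriv (x k)) -
      gateDeriv (x k) * nextRamp w x k + min (x k) 0) = min (x k) 0 * v k -
        w k * linkGate x k * (rampDeriv (x k) * v k) - nextRamp w x k * gateDeriv (x k) * v k := by
    ring
  simp [Finset.sum_add_distrib, e, hs]
  simp only [mul_left_comm (ramp _), ← mul_assoc]
  ring

theorem chain_zero_nonpos {w : ℕ → ℝ} (hw : ∀ k, 0 ≤ w k) : chain w (0 : Vec (M + 1)) ≤ 0 := by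
  refine Finset.sum_nonpos fun k _ => ?_
  have := mul_nonneg (mul_nonneg (hw k) (linkGate_nonneg 0 k)) (ramp_nonneg ((0 : Vec (M + 1)) k))
  simpa using this

theorem neg_le_chain {w : ℕ → ℝ} (hw' : ∀ k, w k ≤ 1) (x : Vec (M + 1)) :
    -(4 * (M + 1)) ≤ chain w x := by
  have h : ∑ _k : Fin (M + 1), (-4 : ℝ) ≤ chain w x := by
    refine Finset.sum_le_sum fun k _ => ?_
    have h1 : w k * linkGate x k ≤ 1 :=
      mul_le_one₀ (hw' k) (linkGate_nonneg x k) (linkGate_le_one x k)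
    have h2 := mul_le_mul_of_nonneg_right h1 (ramp_nonneg (x k))
    have h3 := ramp_le_four (x k)
    have h4 : 0 ≤ (min (x k) 0) ^ 2 / 2 := by positivity
    linarith
  simp at h
  linarith

theorem abs_mul_sub_mul_le {a a' b b' A B : ℝ} (ha : |a| ≤ A) (hb : |b'| ≤ B) :
    |a * b - a' * b'| ≤ A * |b - b'| + B * |a - a'| := by
  have e : a * b - a' * b' = a * (b - b') + b' * (a - a') := by ring
  rw [e]
  refine (abs_add_le _ _).trans ?_
  rw [abs_mul, abs_mul]
  gcongr

/-- The gates are a shifted copy of the coordinates under a 1-Lipschitz map, so the shift costs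
nothing in the Euclidean norm and the Lipschitz constant of the gradient does not depend on M. -/
theorem sum_sq_linkGate_sub_le (x y : Vec (M + 1)) :
    ∑ k, (linkGate x k - linkGate y k) ^ 2 ≤ ‖x - y‖ ^ 2 := by
  rw [EuclideanSpace.norm_sq_eq, Fin.sum_univ_succ, Fin.sum_univ_castSucc]
  simp only [linkGate, Fin.cons_zero, Fin.cons_succ, sub_self, PiLp.sub_apply, Real.norm_eq_abs,
    sq_abs]
  have h : ∑ k : Fin M, (gate (x k.castSucc) - gate (y k.castSucc)) ^ 2 ≤
      ∑ k : Fin M, (x k.castSucc - y k.castSucc) ^ 2 :=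
    Finset.sum_le_sum fun k _ => sq_le_sq.2 (abs_gate_sub_le _ _)
  nlinarith [sq_nonneg (x (Fin.last M) - y (Fin.last M))]

theorem sum_sq_nextRamp_sub_le {w : ℕ → ℝ} (hw : ∀ k, 0 ≤ w k) (hw' : ∀ k, w k ≤ 1)
    (x y : Vec (M + 1)) : ∑ k, (nextRamp w x k - nextRamp w y k) ^ 2 ≤ ‖x - y‖ ^ 2 := by
  rw [EuclideanSpace.norm_sq_eq, Fin.sum_univ_castSucc, Fin.sum_univ_succ]
  simp only [nextRamp, Fin.snoc_castSucc, Fin.snoc_last, sub_self, PiLp.sub_apply,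
    Real.norm_eq_abs, sq_abs]
  have h : ∑ k : Fin M, (w (k + 1) * ramp (x k.succ) - w (k + 1) * ramp (y k.succ)) ^ 2 ≤
      ∑ k : Fin M, (x k.succ - y k.succ) ^ 2 := by
    refine Finset.sum_le_sum fun k _ => sq_le_sq.2 ?_
    rw [← mul_sub, abs_mul, abs_of_nonneg (hw _)]
    exact (mul_le_of_le_one_left (abs_nonneg _) (hw' _)).trans (abs_ramp_sub_le _ _)
  nlinarith [sq_nonneg (x 0 - y 0)]

theorem norm_chainGrad_sub_le {w : ℕ → ℝ} (hw : ∀ k, 0 ≤ w k) (hw' : ∀ k, w k ≤ 1)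
    (x y : Vec (M + 1)) : ‖chainGrad w x - chainGrad w y‖ ≤ 27 * ‖x - y‖ := by
  -- The factor 10 collects 1 from `rampDeriv`, 4 · 2 from `gateDeriv` times a ramp of size at most
  -- 4, and 1 from the quadratic penalty.
  have hk (k : Fin (M + 1)) : |chainGrad w x k - chainGrad w y k| ≤
      |linkGate x k - linkGate y k| + 10 * |x k - y k| + |nextRamp w x k - nextRamp w y k| := by
    have h1 : |linkGate x k * rampDeriv (x k) - linkGate y k * rampDeriv (y k)| ≤
        1 * |rampDeriv (x k) - rampDeriv (y k)| + 1 * |linkGate x k - linkGate y k| :=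
      abs_mul_sub_mul_le (by rw [abs_of_nonneg (linkGate_nonneg x k)]; exact linkGate_le_one x k)
        (by rw [abs_of_nonneg (rampDeriv_nonneg _)]; exact rampDeriv_le_one _)
    have h2 : |gateDeriv (x k) * nextRamp w x k - gateDeriv (y k) * nextRamp w y k| ≤
        1 * |nextRamp w x k - nextRamp w y k| + 4 * |gateDeriv (x k) - gateDeriv (y k)| :=
      abs_mul_sub_mul_le (by rw [abs_of_nonneg (gateDeriv_nonneg _)]; exact gateDeriv_le_one _)
        (by rw [abs_of_nonneg (nextRamp_nonneg hw y k)]; exact nextRamp_le_four hw' y k)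
    have h3 := abs_rampDeriv_sub_le (x k) (y k)
    have h4 := abs_gateDeriv_sub_le (x k) (y k)
    have h5 := abs_min_sub_le (x k) (y k)
    have h6 : |w k * (linkGate x k * rampDeriv (x k) - linkGate y k * rampDeriv (y k))| ≤
        |linkGate x k * rampDeriv (x k) - linkGate y k * rampDeriv (y k)| := by
      rw [abs_mul, abs_of_nonneg (hw k)]
      exact mul_le_of_le_one_left (abs_nonneg _) (hw' k)
    have e : chainGrad w x k - chainGrad w y k =
        -(w k * (linkGate x k * rampDeriv (x k) - linkGate y k * rampDeriv (y k))) -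
        (gateDeriv (x k) * nextRamp w x k - gateDeriv (y k) * nextRamp w y k) +
        (min (x k) 0 - min (y k) 0) := by
      rw [chainGrad_apply, chainGrad_apply]; ring
    rw [e]
    refine (abs_add_le _ _).trans ?_
    have h7 := abs_sub (-(w k * (linkGate x k * rampDeriv (x k) - linkGate y k *
      rampDeriv (y k)))) (gateDeriv (x k) * nextRamp w x k - gateDeriv (y k) * nextRamp w y k)
    rw [abs_neg] at h7
    linarith
  have hsum : ‖chainGrad w x - chainGrad w y‖ ^ 2 ≤ (27 * ‖x - y‖) ^ 2 := by
    -- Cauchy–Schwarz with weights 1, 10, 1. Summing over k gives 12 + 120 + 12 = 144, well within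
    -- 27².
    have h (k : Fin (M + 1)) : (chainGrad w x k - chainGrad w y k) ^ 2 ≤
        12 * (linkGate x k - linkGate y k) ^ 2 + 120 * (x k - y k) ^ 2 +
          12 * (nextRamp w x k - nextRamp w y k) ^ 2 := by
      have h0 := sq_le_sq' (abs_le.1 (hk k)).1 (abs_le.1 (hk k)).2
      rw [← sq_abs (linkGate x k - linkGate y k), ← sq_abs (x k - y k),
        ← sq_abs (nextRamp w x k - nextRamp w y k)]
      generalize |linkGate x k - linkGate y k| = a at *
      generalize |x k - y k| = b at *
      generalize |nextRamp w x k - nextRamp w y k| = c at *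
      nlinarith [sq_nonneg (a - b), sq_nonneg (a - c), sq_nonneg (b - c)]
    have hs := Finset.sum_le_sum (s := Finset.univ) fun (k : Fin (M + 1)) _ => h k
    rw [Finset.sum_add_distrib, Finset.sum_add_distrib, ← Finset.mul_sum, ← Finset.mul_sum,
      ← Finset.mul_sum] at hs
    have h1 := sum_sq_linkGate_sub_le x y
    have h2 := sum_sq_nextRamp_sub_le hw hw' x y
    have h3 : ∑ k, (x k - y k) ^ 2 = ‖x - y‖ ^ 2 := by
      simp [EuclideanSpace.norm_sq_eq]
    have h4 : ‖chainGrad w x - chainGrad w y‖ ^ 2 =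
        ∑ k, (chainGrad w x k - chainGrad w y k) ^ 2 := by
      simp [EuclideanSpace.norm_sq_eq]
    rw [h4]
    nlinarith [sq_nonneg ‖x - y‖]
  exact (sq_le_sq₀ (norm_nonneg _) (by positivity)).1 hsum

theorem chainGrad_of_eq_zero (w : ℕ → ℝ) {x : Vec (M + 1)} {k : Fin (M + 1)} (hk : x k = 0) :
    chainGrad w x k = -(w k * linkGate x k) := by
  rw [chainGrad_apply, hk]
  simp [rampDeriv]

theorem linkGate_eq_zero {x : Vec (M + 1)} {k l : Fin (M + 1)} (hkl : (k : ℕ) = l + 1)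
    (hl : x l = 0) : linkGate x k = 0 := by
  obtain ⟨k', rfl⟩ : ∃ k' : Fin M, k = k'.succ := Fin.exists_succ_eq.2 (by
    rintro rfl; simp at hkl) |>.imp fun _ h => h.symm
  have : k'.castSucc = l := Fin.ext (by simpa using hkl)
  simp [linkGate, this, hl]

/-- Look at the first coordinate j with x_j < 1, which exists since some coordinate is zero. Its
gate is at least 1/2, because the preceding coordinate is at least 1 or j is the first. All three
terms of the derivative are nonpositive, so they cannot cancel: for x_j ≥ -1 the ramp contributes at
least (1/3)(1/2)(1/2) = 1/12, and for x_j < -1 the quadratic penalty contributes at least 1. -/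
theorem norm_chainGrad_ge {w : ℕ → ℝ} (hw : ∀ k, 1 / 3 ≤ w k) {x : Vec (M + 1)}
    (hx : ∃ k, x k = 0) : 1 / 12 ≤ ‖chainGrad w x‖ := by
  classical
  have hex : ∃ j : ℕ, ∃ h : j < M + 1, x ⟨j, h⟩ < 1 := by
    obtain ⟨k, hk⟩ := hx
    exact ⟨k, k.2, by simp [hk]⟩
  obtain ⟨hj, hxj⟩ := Nat.find_spec hex
  set j : Fin (M + 1) := ⟨Nat.find hex, hj⟩ with hjdef
  have hgate : 1 / 2 ≤ linkGate x j := by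
    rcases Fin.eq_zero_or_eq_succ j with h | ⟨i, hi⟩
    · rw [h]; norm_num [linkGate]
    · rw [hi]
      simp only [linkGate, Fin.cons_succ]
      apply half_le_gate
      have hlt : (i.castSucc : ℕ) < Nat.find hex := by
        have : Nat.find hex = (j : ℕ) := rfl
        rw [this, hi]; simp
      have := Nat.find_min hex hlt
      push Not at this
      exact this i.castSucc.2
  have h0 : ∀ k, 0 ≤ w k := fun k => le_trans (by norm_num) (hw k)
  have hle : chainGrad w x j ≤ -(1 / 12) := by
    rw [chainGrad_apply]
    have h1 : 0 ≤ gateDeriv (x j) * nextRamp w x j :=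
      mul_nonneg (gateDeriv_nonneg _) (nextRamp_nonneg h0 x j)
    have h2 : 1 / 6 ≤ w j * linkGate x j := by nlinarith [hw j]
    rcases le_or_gt (-1) (x j) with h | h
    · have h3 := half_le_rampDeriv h hxj.le
      have h4 : min (x j) 0 ≤ 0 := min_le_right _ _
      nlinarith
    · have h3 := rampDeriv_nonneg (x j)
      have h4 : min (x j) 0 ≤ x j := min_le_left _ _
      nlinarith
  have h5 : ‖chainGrad w x j‖ ≤ ‖chainGrad w x‖ := PiLp.norm_apply_le _ _
  rw [Real.norm_eq_abs] at h5
  have := neg_abs_le (chainGrad w x j)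
  linarith

end Chain

/-! ### Supports contained in an initial segment -/

/-- All non-zero coordinates of `x` have an index below `a`. -/
def SupportedBelow {d : ℕ} (a : ℕ) (x : Vec d) : Prop := ∀ k : Fin d, x k ≠ 0 → (k : ℕ) < a

theorem SupportedBelow.mono {d a b : ℕ} {x : Vec d} (h : SupportedBelow a x) (hab : a ≤ b) :
    SupportedBelow b x := fun k hk => (h k hk).trans_le hab

theorem SupportedBelow.zero {d a : ℕ} : SupportedBelow a (0 : Vec d) := fun _ hk => absurd rfl hk

theorem SupportedBelow.smul {d a : ℕ} {x : Vec d} (h : SupportedBelow a x) (c : ℝ) :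
    SupportedBelow a (c • x) := fun k hk => h k fun h0 => hk (by simp [h0])

theorem SupportedBelow.eq_zero {d a : ℕ} {x : Vec d} (h : SupportedBelow a x) {k : Fin d}
    (hk : a ≤ k) : x k = 0 := by
  by_contra h0
  exact absurd (h k h0) (by omega)

theorem supportedBelow_of_mem_span {d a : ℕ} {S : Set (Vec d)} (hS : ∀ v ∈ S, SupportedBelow a v)
    {x : Vec d} (hx : x ∈ Submodule.span ℝ S) : SupportedBelow a x := by
  intro k hk
  by_contra hlt
  refine hk ?_
  induction hx using Submodule.span_induction with
  | mem v hv => exact (hS v hv).eq_zero (not_lt.1 hlt)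
  | zero => rfl
  | add u v _ _ hu hv =>
    by_contra h0
    have h1 : u k = 0 := by by_contra h; exact h (hu h)
    have h2 : v k = 0 := by by_contra h; exact h (hv h)
    exact h0 (by simp [h1, h2])
  | smul c v _ hv =>
    by_contra h0
    have h2 : v k = 0 := by by_contra h; exact h (hv h)
    exact h0 (by simp [h2])

/-! ### Progress along the chain, and scaling to given Δ and L -/

section ScaledChain

variable {M : ℕ}

/-- Beyond coordinate a, both x_k and x_{k-1} vanish: the gate of link k is closed, and since
`gateDeriv` vanishes at 0 the next link exerts no pull on x_k either. -/
theorem SupportedBelow.chainGrad {a : ℕ} {x : Vec (M + 1)} (h : SupportedBelow a x) (w : ℕ → ℝ) :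
    SupportedBelow (a + 1) (chainGrad w x) := by
  intro k hk
  by_contra hlt
  rw [chainGrad_of_eq_zero w (h.eq_zero (by omega)),
    linkGate_eq_zero (l := ⟨k - 1, by omega⟩) (by simp; omega)
      (h.eq_zero (by simp; omega))] at hk
  simp at hk

/-- Only link a could reveal coordinate a, so a worker that does not hold this link makes no
progress. -/
theorem SupportedBelow.chainGrad_of_weight_eq_zero {a : ℕ} {x : Vec (M + 1)}
    (h : SupportedBelow a x) {w : ℕ → ℝ} (hw : w a = 0) : SupportedBelow a (_root_.chainGrad w x) := by
  intro k hk
  have h1 := h.chainGrad w k hk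
  by_contra hlt
  have h2 : (k : ℕ) = a := by omega
  rw [chainGrad_of_eq_zero w (h.eq_zero (by omega)), h2, hw] at hk
  simp at hk

noncomputable def scaledChain (s lam : ℝ) (w : ℕ → ℝ) (x : Vec (M + 1)) : ℝ :=
  s * chain w (lam⁻¹ • x)

noncomputable def scaledGrad (s lam : ℝ) (w : ℕ → ℝ) (x : Vec (M + 1)) : Vec (M + 1) :=
  (s / lam) • chainGrad w (lam⁻¹ • x)

theorem hasGradientAt_scaledChain (s lam : ℝ) (w : ℕ → ℝ) (x : Vec (M + 1)) :
    HasGradientAt (scaledChain s lam w) (scaledGrad s lam w x) x := by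
  rw [hasGradientAt_iff_hasFDerivAt]
  have h := (hasGradientAt_chain w (lam⁻¹ • x)).hasFDerivAt
  have h2 : HasFDerivAt (fun y : Vec (M + 1) => lam⁻¹ • y)
      (lam⁻¹ • ContinuousLinearMap.id ℝ (Vec (M + 1))) x := (hasFDerivAt_id x).const_smul lam⁻¹
  refine ((h.comp x h2).const_mul s).congr_fderiv ?_
  ext v
  simp [scaledGrad]
  ring

theorem gradient_scaledChain (s lam : ℝ) (w : ℕ → ℝ) (x : Vec (M + 1)) :
    ∇ (scaledChain s lam w) x = scaledGrad s lam w x :=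
  (hasGradientAt_scaledChain s lam w x).gradient

/-- The chain is affine in its weights, with a penalty common to all workers, so averaging the
workers averages the weights. -/
theorem globalObjective_scaledChain {n : ℕ} (hn : n ≠ 0) (s lam : ℝ) (w : Fin n → ℕ → ℝ) :
    globalObjective (fun i => scaledChain (M := M) s lam (w i)) =
      scaledChain s lam fun k => (n : ℝ)⁻¹ * ∑ i, w i k := by
  funext x
  have hn' : (n : ℝ) ≠ 0 := by exact_mod_cast hn
  unfold globalObjective scaledChain chain
  rw [← Finset.mul_sum, Finset.sum_comm, mul_left_comm, Finset.mul_sum]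
  congr 1
  refine Finset.sum_congr rfl fun k _ => ?_
  rw [Finset.sum_add_distrib, Finset.sum_neg_distrib, ← Finset.sum_mul, ← Finset.sum_mul]
  simp
  field_simp

theorem inFunctionClass_scaledChain {n : ℕ} (hn : n ≠ 0) {s lam Δ L : ℝ} (hs : 0 ≤ s)
    (hlam : 0 < lam) {w : Fin n → ℕ → ℝ} (hw : ∀ i k, 0 ≤ w i k) (hw' : ∀ i k, w i k ≤ 1)
    (hL : 27 * s / lam ^ 2 ≤ L) (hΔ : s * (4 * (M + 1)) ≤ Δ) :
    InFunctionClass Δ L (0 : Vec (M + 1)) fun i => scaledChain s lam (w i) := by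
  have hn' : (0 : ℝ) < n := by exact_mod_cast Nat.pos_of_ne_zero hn
  have hv0 (k : ℕ) : 0 ≤ (n : ℝ)⁻¹ * ∑ i, w i k :=
    mul_nonneg (by positivity) (Finset.sum_nonneg fun i _ => hw i k)
  have hv1 (k : ℕ) : (n : ℝ)⁻¹ * ∑ i, w i k ≤ 1 := by
    rw [inv_mul_le_iff₀ hn', mul_one]
    simpa using Finset.sum_le_sum fun i (_ : i ∈ Finset.univ) => hw' i k
  have hlow (x : Vec (M + 1)) :
      -(s * (4 * (M + 1))) ≤ globalObjective (fun i => scaledChain s lam (w i)) x := by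
    rw [globalObjective_scaledChain hn, scaledChain, ← mul_neg]
    exact mul_le_mul_of_nonneg_left (neg_le_chain hv1 _) hs
  refine ⟨fun i x => (hasGradientAt_scaledChain s lam (w i) x).differentiableAt, fun i x y => ?_,
    ⟨_, Set.forall_mem_range.2 hlow⟩, ?_⟩
  · rw [gradient_scaledChain, gradient_scaledChain, scaledGrad, scaledGrad, ← smul_sub, norm_smul,
      Real.norm_of_nonneg (by positivity)]
    have h := norm_chainGrad_sub_le (hw i) (hw' i) (lam⁻¹ • x) (lam⁻¹ • y)
    rw [← smul_sub, norm_smul, Real.norm_of_nonneg (by positivity)] at h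
    calc s / lam * ‖chainGrad (w i) (lam⁻¹ • x) - chainGrad (w i) (lam⁻¹ • y)‖
        ≤ s / lam * (27 * (lam⁻¹ * ‖x - y‖)) := by gcongr
      _ = 27 * s / lam ^ 2 * ‖x - y‖ := by field_simp
      _ ≤ L * ‖x - y‖ := by gcongr
  · have h0 : globalObjective (fun i => scaledChain s lam (w i)) (0 : Vec (M + 1)) ≤ 0 := by
      rw [globalObjective_scaledChain hn, scaledChain, smul_zero]
      exact mul_nonpos_of_nonneg_of_nonpos hs (chain_zero_nonpos hv0)
    have h1 := le_ciInf hlow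
    linarith

theorem SupportedBelow.scaledGrad {a : ℕ} {x : Vec (M + 1)} (h : SupportedBelow a x) (s lam : ℝ)
    (w : ℕ → ℝ) : SupportedBelow (a + 1) (scaledGrad s lam w x) :=
  ((h.smul _).chainGrad w).smul _

theorem SupportedBelow.scaledGrad_of_weight_eq_zero {a : ℕ} {x : Vec (M + 1)}
    (h : SupportedBelow a x) (s lam : ℝ) {w : ℕ → ℝ} (hw : w a = 0) :
    SupportedBelow a (_root_.scaledGrad s lam w x) :=
  ((h.smul _).chainGrad_of_weight_eq_zero hw).smul _

theorem norm_scaledGrad_ge {s lam : ℝ} (hs : 0 ≤ s) (hlam : 0 < lam) {w : ℕ → ℝ}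
    (hw : ∀ k, 1 / 3 ≤ w k) {a : ℕ} {x : Vec (M + 1)} (h : SupportedBelow a x) (ha : a ≤ M) :
    s / lam / 12 ≤ ‖_root_.scaledGrad s lam w x‖ := by
  rw [_root_.scaledGrad, norm_smul, Real.norm_of_nonneg (by positivity)]
  have := norm_chainGrad_ge hw ⟨Fin.last M, (h.smul lam⁻¹).eq_zero (k := Fin.last M) (by simpa)⟩
  rw [div_eq_mul_one_div _ (12 : ℝ)]
  gcongr

theorem continuous_scaledGrad {s lam : ℝ} {w : ℕ → ℝ} (hw : ∀ k, 0 ≤ w k) (hw' : ∀ k, w k ≤ 1) :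
    Continuous (scaledGrad (M := M) s lam w) := by
  have h : LipschitzWith 27 (chainGrad (M := M) w) :=
    LipschitzWith.of_dist_le_mul fun x y => by
      simpa [dist_eq_norm] using norm_chainGrad_sub_le hw hw' x y
  exact (h.continuous.comp (continuous_const_smul lam⁻¹)).const_smul (s / lam)

end ScaledChain

/-! ### Propagation of supports in an execution -/

namespace Execution

variable {n d : ℕ} {O : Fin n → StochasticOracle d} {C : WorkerCompressors n d} {T : ℕ}
  {Ω : Type*} [mΩ : MeasurableSpace Ω] {P : Measure Ω}

/-- If the oracle answers of iteration `t` stay below the levels `mid t i` and the compressed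
messages stay below the levels `server t`, then a zero-respecting algorithm keeps its local models
below the levels `worker t i`. -/
theorem supportedBelow_model (A : Execution O C T 0 P) (hn : 0 < n) {w : Ω}
    (hquery : ∀ t ∈ Finset.Icc 1 T, ∀ i k, A.query t i w k ≠ 0 → A.WorkerHas t t t i k w)
    (hmodel : ∀ t ∈ Finset.Icc 1 T, ∀ i k,
      A.model t i w k ≠ 0 → A.WorkerHas t (t + 1) (t + 1) i k w)
    (hmessage : ∀ t ∈ Finset.Icc 1 T, ∀ i (j : Fin T) k, (j : ℕ) < A.rounds t w →
      A.message t i j w k ≠ 0 → A.WorkerHas t (t + 1) t i k w)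
    (hbroadcast : ∀ t ∈ Finset.Icc 1 T, ∀ (j : Fin T) k, (j : ℕ) < A.rounds t w →
      A.broadcast t j w k ≠ 0 → A.ServerHas t k w)
    {server : ℕ → ℕ} {worker mid : ℕ → Fin n → ℕ}
    (hserver : Monotone server) (hworker : ∀ i, Monotone fun t => worker t i)
    (hmid : ∀ t i, mid t i ≤ worker t i) (hmid' : ∀ t i, worker t i ≤ mid (t + 1) i)
    (hsw : ∀ t i, server t ≤ worker t i)
    (hanswer : ∀ t < T, ∀ i, SupportedBelow (worker t i) (A.query (t + 1) i w) →
      SupportedBelow (mid (t + 1) i) (A.answer (t + 1) i w))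
    (hreceived : ∀ t < T, ∀ i (j : Fin T), (j : ℕ) < A.rounds (t + 1) w →
      SupportedBelow (mid (t + 1) i) (A.message (t + 1) i j w) →
      SupportedBelow (server (t + 1)) (A.received (t + 1) i j w)) :
    ∀ t ≤ T, ∀ i, SupportedBelow (worker t i) (A.model t i w) := by
  -- The induction must carry the answers, received messages and broadcasts along with the models,
  -- since each of them can bring in coordinates later.
  have key : ∀ t ≤ T, ∀ i, SupportedBelow (worker t i) (A.model t i w) ∧
      (1 ≤ t → SupportedBelow (mid t i) (A.answer t i w) ∧
        ∀ j : Fin T, (j : ℕ) < A.rounds t w → SupportedBelow (server t) (A.received t i j w) ∧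
          SupportedBelow (server t) (A.broadcast t j w)) := by
    intro t
    induction t using Nat.strong_induction_on with
    | _ t ih =>
      intro ht
      rcases Nat.eq_zero_or_pos t with rfl | hpos
      · intro i
        refine ⟨?_, fun h => absurd h (by norm_num)⟩
        rw [A.model_zero]
        exact SupportedBelow.zero
      obtain ⟨t, rfl⟩ : ∃ u, t = u + 1 := ⟨t - 1, by omega⟩
      have hmem : t + 1 ∈ Finset.Icc 1 T := by simp; omega
      have htT : t < T := by omega
      have old {s : ℕ} (hs : s < t + 1) (i : Fin n) := ih s hs (by omega) i
      have hq (i : Fin n) : SupportedBelow (worker t i) (A.query (t + 1) i w) := by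
        intro k hk
        rcases hquery _ hmem i k hk with ⟨s, hs, h⟩ | ⟨s, hs1, hs, h⟩ | ⟨s, hs1, hs, j, hj, h⟩ |
          ⟨s, hs1, hs, j, hj, h⟩
        · exact ((old hs i).1 k h).trans_le (hworker i (by omega))
        · exact (((old hs i).2 hs1).1 k h).trans_le ((hmid s i).trans (hworker i (by omega)))
        · exact ((((old hs i).2 hs1).2 j hj).2 k h).trans_le
            ((hsw s i).trans (hworker i (by omega)))
        · exact ((((old hs i).2 hs1).2 j hj).1 k h).trans_le
            ((hsw s i).trans (hworker i (by omega)))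
      have ha (i : Fin n) := hanswer t htT i (hq i)
      have hm (i : Fin n) (j : Fin T) (hj : (j : ℕ) < A.rounds (t + 1) w) :
          SupportedBelow (mid (t + 1) i) (A.message (t + 1) i j w) := by
        intro k hk
        rcases hmessage _ hmem i j k hj hk with ⟨s, hs, h⟩ | ⟨s, hs1, hs, h⟩ |
          ⟨s, hs1, hs, j, hj, h⟩ | ⟨s, hs1, hs, j, hj, h⟩
        · exact ((old hs i).1 k h).trans_le ((hworker i (by omega)).trans (hmid' t i))
        · rcases Nat.lt_or_ge s (t + 1) with hlt | hge
          · exact (((old hlt i).2 hs1).1 k h).trans_le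
              ((hmid s i).trans ((hworker i (by omega)).trans (hmid' t i)))
          · obtain rfl : s = t + 1 := by omega
            exact ha i k h
        · exact ((((old hs i).2 hs1).2 j hj).2 k h).trans_le
            ((hsw s i).trans ((hworker i (by omega)).trans (hmid' t i)))
        · exact ((((old hs i).2 hs1).2 j hj).1 k h).trans_le
            ((hsw s i).trans ((hworker i (by omega)).trans (hmid' t i)))
      have hr (i : Fin n) (j : Fin T) (hj : (j : ℕ) < A.rounds (t + 1) w) :=
        hreceived t htT i j hj (hm i j hj)
      have hb (j : Fin T) (hj : (j : ℕ) < A.rounds (t + 1) w) :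
          SupportedBelow (server (t + 1)) (A.broadcast (t + 1) j w) := by
        intro k hk
        rcases hbroadcast _ hmem j k hj hk with ⟨s, hs1, hs, i, j, hj, h⟩ | ⟨s, hs1, hs, j, hj, h⟩
        · rcases Nat.lt_or_ge s (t + 1) with hlt | hge
          · exact ((((old hlt i).2 hs1).2 j hj).1 k h).trans_le (hserver (by omega))
          · obtain rfl : s = t + 1 := by omega
            exact hr i j hj k h
        -- The bound on broadcasts is part of the statement for each worker; any worker will do.
        · exact ((((old hs ⟨0, hn⟩).2 hs1).2 j hj).2 k h).trans_le (hserver (by omega))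
      intro i
      refine ⟨?_, fun _ => ⟨ha i, fun j hj => ⟨hr i j hj, hb j hj⟩⟩⟩
      intro k hk
      rcases hmodel _ hmem i k hk with ⟨s, hs, h⟩ | ⟨s, hs1, hs, h⟩ |
        ⟨s, hs1, hs, j, hj, h⟩ | ⟨s, hs1, hs, j, hj, h⟩
      · exact ((old hs i).1 k h).trans_le (hworker i (by omega))
      · rcases Nat.lt_or_ge s (t + 1) with hlt | hge
        · exact (((old hlt i).2 hs1).1 k h).trans_le ((hmid s i).trans (hworker i (by omega)))
        · obtain rfl : s = t + 1 := by omega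
          exact (ha i k h).trans_le (hmid _ i)
      · rcases Nat.lt_or_ge s (t + 1) with hlt | hge
        · exact ((((old hlt i).2 hs1).2 j hj).2 k h).trans_le
            ((hsw s i).trans (hworker i (by omega)))
        · obtain rfl : s = t + 1 := by omega
          exact (hb j hj k h).trans_le (hsw _ i)
      · rcases Nat.lt_or_ge s (t + 1) with hlt | hge
        · exact ((((old hlt i).2 hs1).2 j hj).1 k h).trans_le
            ((hsw s i).trans (hworker i (by omega)))
        · obtain rfl : s = t + 1 := by omega
          exact (hr i j hj k h).trans_le (hsw _ i)
  exact fun t ht i => (key t ht i).1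

/-! ### The seeds are fresh -/

theorem between_le_ambient (A : Execution O C T 0 P) (t : ℕ) : A.between t ≤ mΩ :=
  (A.between_le t).trans (A.le_ambient (t + 1))

theorem measurableSet_oracleSeed (A : Execution O C T 0 P) {t : ℕ} (ht : t ∈ Finset.Icc 1 T)
    (i : Fin n) {S : Set (O i).Seed} (hS : MeasurableSet S) :
    MeasurableSet {w | A.oracleSeed t w i ∈ S} := by
  have h := (A.measurable_oracleSeed t ht).mono (A.between_le_ambient t) le_rfl
  exact (measurable_pi_apply i).comp h hS

theorem measure_oracleSeed (A : Execution O C T 0 P) {t : ℕ} (ht : t ∈ Finset.Icc 1 T)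
    (i : Fin n) {S : Set (O i).Seed} (hS : MeasurableSet S) :
    P {w | A.oracleSeed t w i ∈ S} = (O i).law S := by
  have h := (A.measurable_oracleSeed t ht).mono (A.between_le_ambient t) le_rfl
  have h2 := (measurePreserving_eval (fun i => (O i).law) i).measure_preimage hS.nullMeasurableSet
  rw [← h2, ← A.law_oracleSeed t ht, Measure.map_apply h (measurable_pi_apply i hS)]
  rfl

theorem measurableSet_lt_rounds (A : Execution O C T 0 P) {t : ℕ} (ht : t ∈ Finset.Icc 1 T)
    (j : ℕ) : MeasurableSet[A.between t] {w | j < A.rounds t w} :=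
  A.measurable_rounds t ht (MeasurableSet.of_discrete (s := Set.Ioi j))

theorem measurableSet_roundSeed (A : Execution O C T 0 P) {t : ℕ} (ht : t ∈ Finset.Icc 1 T)
    (j : Fin T) {S : Set C.Seed} (hS : MeasurableSet S) :
    MeasurableSet {w | A.roundSeed t w j ∈ S} := by
  have h := (A.measurable_roundSeed t ht).mono (A.le_ambient (t + 1)) le_rfl
  exact (measurable_pi_apply j).comp h hS

/-- Whether round j takes place is decided before the compressor seeds of the iteration are drawn,
so adaptive scheduling cannot favour lucky seeds. -/
theorem measure_lt_rounds_inter_roundSeed (A : Execution O C T 0 P) {t : ℕ}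
    (ht : t ∈ Finset.Icc 1 T) (j : Fin T) {S : Set C.Seed} (hS : MeasurableSet S) :
    P ({w | (j : ℕ) < A.rounds t w} ∩ {w | A.roundSeed t w j ∈ S}) =
      P {w | (j : ℕ) < A.rounds t w} * C.law S := by
  have h := (A.measurable_roundSeed t ht).mono (A.le_ambient (t + 1)) le_rfl
  have h2 := (measurePreserving_eval (fun _ : Fin T => C.law) j).measure_preimage
    hS.nullMeasurableSet
  have hlaw : P {w | A.roundSeed t w j ∈ S} = C.law S := by
    rw [← h2, ← A.law_roundSeed t ht, Measure.map_apply h (measurable_pi_apply j hS)]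
    rfl
  rw [← hlaw, Set.inter_comm, mul_comm]
  exact (Indep_iff _ _ P).1 (A.indep_roundSeed t ht) _ _
    ⟨_, measurable_pi_apply j hS, rfl⟩ (A.measurableSet_lt_rounds ht j)

/-- The sum is the expected total number of rounds, which never exceeds T. -/
theorem sum_measure_lt_rounds_le [IsProbabilityMeasure P] (A : Execution O C T 0 P) :
    ∑ t ∈ Finset.Icc 1 T, ∑ j : Fin T, P {w | (j : ℕ) < A.rounds t w} ≤ T := by
  have hmeas (t : ℕ) (ht : t ∈ Finset.Icc 1 T) (j : Fin T) :
      MeasurableSet {w | (j : ℕ) < A.rounds t w} :=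
    A.between_le_ambient t _ (A.measurableSet_lt_rounds ht j)
  calc ∑ t ∈ Finset.Icc 1 T, ∑ j : Fin T, P {w | (j : ℕ) < A.rounds t w}
      = ∑ t ∈ Finset.Icc 1 T, ∑ j : Fin T,
          ∫⁻ w, {w | (j : ℕ) < A.rounds t w}.indicator 1 w ∂P :=
        Finset.sum_congr rfl fun t ht => Finset.sum_congr rfl fun j _ =>
          (lintegral_indicator_one (hmeas t ht j)).symm
    _ = ∫⁻ w, ∑ t ∈ Finset.Icc 1 T, ∑ j : Fin T,
          {w | (j : ℕ) < A.rounds t w}.indicator 1 w ∂P := by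
        rw [lintegral_finsetSum' _ fun t ht => (Finset.measurable_sum _ fun j _ =>
          measurable_one.indicator (hmeas t ht j)).aemeasurable]
        refine Finset.sum_congr rfl fun t ht => ?_
        rw [lintegral_finsetSum _ fun j _ => measurable_one.indicator (hmeas t ht j)]
    _ ≤ ∫⁻ _, (T : ENNReal) ∂P := by
        refine lintegral_mono fun w => ?_
        refine le_trans (Finset.sum_le_sum (g := fun t => (A.rounds t w : ENNReal)) fun t _ => ?_)
          (by exact_mod_cast A.rounds_le w)
        simp only [Set.indicator_apply, Set.mem_ofPred_eq, Pi.one_apply]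
        rw [Finset.sum_boole]
        refine Nat.cast_le.2 ?_
        calc (Finset.univ.filter fun j : Fin T => (j : ℕ) < A.rounds t w).card
            ≤ (Finset.range (A.rounds t w)).card :=
              Finset.card_le_card_of_injOn (fun j => (j : ℕ)) (fun j hj => by simpa using hj)
                (fun a _ b _ h => Fin.ext h)
          _ = A.rounds t w := Finset.card_range _
    _ = T := by simp

end Execution

/-! ### Counting events -/

open Classical in
/-- The number of the events `E 1, …, E t` that occur. -/
noncomputable def occurrences {Ω : Type*} (E : ℕ → Set Ω) (t : ℕ) (w : Ω) : ℕ :=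
  ((Finset.Icc 1 t).filter fun s => w ∈ E s).card

theorem occurrences_succ_of_mem {Ω : Type*} {E : ℕ → Set Ω} {t : ℕ} {w : Ω} (h : w ∈ E (t + 1)) :
    occurrences E (t + 1) w = occurrences E t w + 1 := by
  classical
  unfold occurrences
  rw [← Finset.insert_Icc_right_eq_Icc_add_one (by omega), Finset.filter_insert, if_pos h,
    Finset.card_insert_of_notMem (by simp)]

theorem occurrences_succ_of_notMem {Ω : Type*} {E : ℕ → Set Ω} {t : ℕ} {w : Ω}
    (h : w ∉ E (t + 1)) : occurrences E (t + 1) w = occurrences E t w := by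
  classical
  unfold occurrences
  rw [← Finset.insert_Icc_right_eq_Icc_add_one (by omega), Finset.filter_insert, if_neg h]

theorem monotone_occurrences {Ω : Type*} (E : ℕ → Set Ω) (w : Ω) :
    Monotone fun t => occurrences E t w := by
  refine monotone_nat_of_le_succ fun t => ?_
  by_cases h : w ∈ E (t + 1)
  · rw [occurrences_succ_of_mem h]; omega
  · rw [occurrences_succ_of_notMem h]

theorem natCast_occurrences {Ω : Type*} (E : ℕ → Set Ω) (t : ℕ) (w : Ω) :
    (occurrences E t w : ENNReal) = ∑ s ∈ Finset.Icc 1 t, (E s).indicator 1 w := by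
  classical
  simp only [Set.indicator_apply, Pi.one_apply]
  rw [Finset.sum_boole]
  rfl

theorem measurable_natCast_occurrences {Ω : Type*} [MeasurableSpace Ω] {T : ℕ}
    {E : ℕ → Set Ω} (hE : ∀ t ∈ Finset.Icc 1 T, MeasurableSet (E t)) :
    Measurable fun w => (occurrences E T w : ENNReal) := by
  simp only [natCast_occurrences]
  exact Finset.measurable_sum _ fun t ht => measurable_one.indicator (hE t ht)

theorem setOf_le_occurrences {Ω : Type*} (E : ℕ → Set Ω) (T m : ℕ) :
    {w | m ≤ occurrences E T w} = {w | (m : ENNReal) ≤ occurrences E T w} := by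
  ext w
  simp only [Set.mem_ofPred_eq, Nat.cast_le]

theorem measurableSet_le_occurrences {Ω : Type*} [MeasurableSpace Ω] {T : ℕ}
    {E : ℕ → Set Ω} (hE : ∀ t ∈ Finset.Icc 1 T, MeasurableSet (E t)) (m : ℕ) :
    MeasurableSet {w | m ≤ occurrences E T w} := by
  rw [setOf_le_occurrences]
  exact measurableSet_le measurable_const (measurable_natCast_occurrences hE)

/-- Markov's inequality and linearity of expectation; the events may depend on each other. -/
theorem mul_measure_occurrences_ge_le {Ω : Type*} [MeasurableSpace Ω] (P : Measure Ω) {T : ℕ}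
    {E : ℕ → Set Ω} (hE : ∀ t ∈ Finset.Icc 1 T, MeasurableSet (E t)) (m : ℕ) :
    (m : ENNReal) * P {w | m ≤ occurrences E T w} ≤ ∑ t ∈ Finset.Icc 1 T, P (E t) := by
  rw [setOf_le_occurrences]
  refine (mul_meas_ge_le_lintegral (measurable_natCast_occurrences hE) _).trans ?_
  simp only [natCast_occurrences]
  rw [lintegral_finsetSum' _ fun t ht => (measurable_one.indicator (hE t ht)).aemeasurable]
  exact Finset.sum_le_sum fun t ht => (lintegral_indicator_one (hE t ht)).le

/-! ### A biased coin, and the oracles and compressors that it drives -/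

noncomputable def coin (p : unitInterval) : Measure Bool :=
  ENNReal.ofReal p • Measure.dirac true + ENNReal.ofReal (1 - p) • Measure.dirac false

instance (p : unitInterval) : IsProbabilityMeasure (coin p) := ⟨by
  have h0 := p.2.1
  have h1 := p.2.2
  rw [coin]
  simp only [Measure.coe_add, Measure.coe_smul, Pi.add_apply, Pi.smul_apply, measure_univ,
    smul_eq_mul, mul_one]
  rw [← ENNReal.ofReal_add h0 (by linarith)]
  simp⟩

theorem coin_true (p : unitInterval) : coin p {true} = ENNReal.ofReal p := by
  simp [coin]

theorem integral_coin {E : Type*} [NormedAddCommGroup E] [NormedSpace ℝ E] [CompleteSpace E]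
    (p : unitInterval) (g : Bool → E) :
    ∫ z, g z ∂(coin p) = (p : ℝ) • g true + (1 - p : ℝ) • g false := by
  have h0 := p.2.1
  have h1 := p.2.2
  have : IsFiniteMeasure (ENNReal.ofReal p • Measure.dirac true) :=
    Measure.smul_finite _ ENNReal.ofReal_ne_top
  have : IsFiniteMeasure (ENNReal.ofReal (1 - p) • Measure.dirac false) :=
    Measure.smul_finite _ ENNReal.ofReal_ne_top
  rw [coin, integral_add_measure (Integrable.of_finite) (Integrable.of_finite),
    integral_smul_measure, integral_smul_measure, integral_dirac, integral_dirac,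
    ENNReal.toReal_ofReal h0, ENNReal.toReal_ofReal (by linarith)]

/-- The factor of mean one that a coin of bias `p` gives. -/
noncomputable def coinFactor (p : unitInterval) (z : Bool) : ℝ := if z then (p : ℝ)⁻¹ else 0

/-- All workers keep the message `x`, rescaled, or drop it, as decided by one common coin. -/
noncomputable def coinCompressors (n d : ℕ) (q : unitInterval) : WorkerCompressors n d where
  Seed := Bool
  law := coin q
  compress _ z x := coinFactor q z • x
  measurable_compress _ :=
    (Measurable.comp (g := coinFactor q) (measurable_of_finite _) measurable_fst).smul
      measurable_snd

theorem isUnbiased_coinCompressors (n d : ℕ) {q : unitInterval} (hq : (0 : ℝ) < q) {ω : ℝ}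
    (hω : (q : ℝ)⁻¹ - 1 ≤ ω) : (coinCompressors n d q).IsUnbiased ω := by
  refine ⟨fun i x => Integrable.of_finite (μ := coin q), fun i x => ?_,
    fun i x => Integrable.of_finite (μ := coin q), fun i x => ?_⟩
  · refine (integral_coin q (fun z => coinFactor q z • x)).trans ?_
    simp [coinFactor, smul_smul, hq.ne']
  · refine (integral_coin q (fun z => ‖coinFactor q z • x - x‖ ^ 2)).trans_le ?_
    have e (z : Bool) : ‖coinFactor q z • x - x‖ ^ 2 = (coinFactor q z - 1) ^ 2 * ‖x‖ ^ 2 := by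
      rw [show coinFactor q z • x - x = (coinFactor q z - 1) • x by rw [sub_smul, one_smul],
        norm_smul, mul_pow, Real.norm_eq_abs, sq_abs]
    calc (q : ℝ) • ‖coinFactor q true • x - x‖ ^ 2 + (1 - q : ℝ) • ‖coinFactor q false • x - x‖ ^ 2
        = ((q : ℝ)⁻¹ - 1) * ‖x‖ ^ 2 := by
          rw [e, e]
          simp only [coinFactor, smul_eq_mul, if_true, Bool.false_eq_true, if_false]
          field_simp
          ring
      _ ≤ ω * ‖x‖ ^ 2 := by gcongr

/-! ### The oracle that hides progress, and its variance -/

section Oracle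

variable {M : ℕ}

open Classical in
/-- The part of the scaled gradient in the coordinates that start a run of zeros of `x` up to the
last coordinate: it is where a query at `x` makes progress along the chain. -/
noncomputable def freshGrad (s lam : ℝ) (w : ℕ → ℝ) (x : Vec (M + 1)) : Vec (M + 1) :=
  WithLp.toLp 2 fun k => if ∀ l, k ≤ l → x l = 0 then scaledGrad s lam w x k else 0

theorem measurable_freshGrad (s lam : ℝ) {w : ℕ → ℝ} (hw : ∀ k, 0 ≤ w k) (hw' : ∀ k, w k ≤ 1) :
    Measurable (freshGrad (M := M) s lam w) := by
  refine (WithLp.measurable_toLp 2 _).comp (measurable_pi_lambda _ fun k => ?_)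
  refine Measurable.ite ?_ ?_ measurable_const
  · rw [show {x : Vec (M + 1) | ∀ l, k ≤ l → x l = 0} =
      ⋂ l, ⋂ _ : k ≤ l, {x : Vec (M + 1) | x l = 0} by ext; simp]
    refine IsClosed.measurableSet (isClosed_iInter fun l => isClosed_iInter fun _ => ?_)
    exact isClosed_eq (EuclideanSpace.proj l : Vec (M + 1) →L[ℝ] ℝ).continuous continuous_const
  · exact ((EuclideanSpace.proj k : Vec (M + 1) →L[ℝ] ℝ).continuous.comp
      (continuous_scaledGrad hw hw')).measurable

/-- At most one coordinate survives: a later one in the same run of zeros has a zero predecessor,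
hence a closed gate. At the surviving coordinate, where x_k = 0, the unscaled derivative is a weight
times a gate, at most 1 in size. The variance is thus independent of the dimension. -/
theorem norm_sq_freshGrad_le (s lam : ℝ) {w : ℕ → ℝ} (hw : ∀ k, 0 ≤ w k) (hw' : ∀ k, w k ≤ 1)
    (x : Vec (M + 1)) : ‖freshGrad s lam w x‖ ^ 2 ≤ (s / lam) ^ 2 := by
  have hval (k : Fin (M + 1)) (hk : freshGrad s lam w x k ≠ 0) :
      (∀ l, k ≤ l → x l = 0) ∧
        freshGrad s lam w x k = s / lam * -(w k * linkGate (lam⁻¹ • x) k) := by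
    by_cases h : ∀ l, k ≤ l → x l = 0
    · refine ⟨h, ?_⟩
      have hx : (lam⁻¹ • x) k = 0 := by simp [h k le_rfl]
      simp only [freshGrad, if_pos h]
      rw [scaledGrad, PiLp.smul_apply, chainGrad_of_eq_zero w hx, smul_eq_mul]
    · exact absurd (by simp only [freshGrad, if_neg h]) hk
  have hlater (k l : Fin (M + 1)) (hkl : k < l) (hk : freshGrad s lam w x k ≠ 0) :
      freshGrad s lam w x l = 0 := by
    by_contra hl
    have h1 := (hval k hk).1 ⟨l - 1, by omega⟩ (by rw [Fin.le_def]; simp; omega)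
    rw [(hval l hl).2, linkGate_eq_zero (l := ⟨l - 1, by omega⟩) (by simp; omega)
      (by simp [h1])] at hl
    simp at hl
  rw [EuclideanSpace.norm_sq_eq]
  by_cases hex : ∃ k, freshGrad s lam w x k ≠ 0
  · obtain ⟨k, hk⟩ := hex
    rw [Finset.sum_eq_single k (fun l _ hlk => ?_) (by simp)]
    · rw [(hval k hk).2, Real.norm_eq_abs, sq_abs, mul_pow]
      have h0 := mul_nonneg (hw k) (linkGate_nonneg (lam⁻¹ • x) k)
      have h1 : w k * linkGate (lam⁻¹ • x) k ≤ 1 :=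
        mul_le_one₀ (hw' k) (linkGate_nonneg _ k) (linkGate_le_one _ k)
      refine mul_le_of_le_one_right (sq_nonneg _) ?_
      rw [neg_sq]
      exact pow_le_one₀ h0 h1
    · rcases lt_or_gt_of_ne hlk with h | h
      · by_contra hl
        exact hk (hlater l k h fun h0 => hl (by simp [h0]))
      · simp [hlater k l h hk]
  · push Not at hex
    rw [Finset.sum_eq_zero fun k _ => by simp [hex k]]
    positivity

/-- The exact gradient, except that progress along the chain is only revealed by the coin. -/
noncomputable def chainOracle (p : unitInterval) (s lam : ℝ) {w : ℕ → ℝ} (hw : ∀ k, 0 ≤ w k)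
    (hw' : ∀ k, w k ≤ 1) : StochasticOracle (M + 1) where
  Seed := Bool
  law := coin p
  eval z x := scaledGrad s lam w x + (coinFactor p z - 1) • freshGrad s lam w x
  measurable_eval :=
    ((continuous_scaledGrad hw hw').measurable.comp measurable_snd).add
      (((Measurable.comp (g := coinFactor p) (measurable_of_finite _) measurable_fst).sub_const
        1).smul ((measurable_freshGrad s lam hw hw').comp measurable_snd))

theorem inClass_chainOracle {p : unitInterval} (hp : (0 : ℝ) < p) {s lam σ : ℝ} {w : ℕ → ℝ}
    (hw : ∀ k, 0 ≤ w k) (hw' : ∀ k, w k ≤ 1) (hσ : (s / lam) ^ 2 * ((p : ℝ)⁻¹ - 1) ≤ σ ^ 2) :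
    (chainOracle (M := M) p s lam hw hw').InClass (scaledChain s lam w) σ := by
  refine ⟨fun x => Integrable.of_finite (μ := coin p), fun x => ?_,
    fun x => Integrable.of_finite (μ := coin p), fun x => ?_⟩
  · refine (integral_coin p (fun z => scaledGrad s lam w x +
      (coinFactor p z - 1) • freshGrad s lam w x)).trans ?_
    rw [gradient_scaledChain]
    simp only [coinFactor, if_true, Bool.false_eq_true, if_false]
    ext k
    simp
    field_simp
    ring
  · rw [gradient_scaledChain]
    refine (integral_coin p (fun z => ‖scaledGrad s lam w x +
      (coinFactor p z - 1) • freshGrad s lam w x - scaledGrad s lam w x‖ ^ 2)).trans_le ?_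
    have e (z : Bool) : ‖scaledGrad s lam w x + (coinFactor p z - 1) • freshGrad s lam w x -
        scaledGrad s lam w x‖ ^ 2 = (coinFactor p z - 1) ^ 2 * ‖freshGrad s lam w x‖ ^ 2 := by
      rw [add_sub_cancel_left, norm_smul, mul_pow, Real.norm_eq_abs, sq_abs]
    have hp1 : 0 ≤ (p : ℝ)⁻¹ - 1 := sub_nonneg.2 ((one_le_inv₀ hp).2 p.2.2)
    refine le_trans (le_of_eq ?_) ((mul_le_mul_of_nonneg_right
      (norm_sq_freshGrad_le s lam hw hw' x) hp1).trans hσ)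
    rw [e, e]
    simp only [coinFactor, smul_eq_mul, if_true, Bool.false_eq_true, if_false]
    field_simp
    ring

theorem supportedBelow_chainOracle_eval (p : unitInterval) (s lam : ℝ) {w : ℕ → ℝ}
    (hw : ∀ k, 0 ≤ w k) (hw' : ∀ k, w k ≤ 1) (z : Bool) {x : Vec (M + 1)} {a : ℕ}
    (h : SupportedBelow a (scaledGrad s lam w x)) :
    SupportedBelow a ((chainOracle p s lam hw hw').eval z x) := by
  intro k hk
  refine h k fun h0 => hk ?_
  simp [chainOracle, freshGrad, h0]

/-- Every coordinate from a on starts a run of zeros up to the end, so there the fresh part equals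
the gradient and a false coin cancels it. -/
theorem supportedBelow_chainOracle_eval_false (p : unitInterval) (s lam : ℝ) {w : ℕ → ℝ}
    (hw : ∀ k, 0 ≤ w k) (hw' : ∀ k, w k ≤ 1) {x : Vec (M + 1)} {a : ℕ}
    (h : SupportedBelow a x) :
    SupportedBelow a ((chainOracle p s lam hw hw').eval false x) := by
  intro k hk
  by_contra hlt
  refine hk ?_
  have hz : ∀ l, k ≤ l → x l = 0 := fun l hl => h.eq_zero (by rw [Fin.le_def] at hl; omega)
  simp only [chainOracle, coinFactor, freshGrad, PiLp.add_apply, PiLp.smul_apply, if_pos hz]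
  simp

end Oracle

/-! ### The lower bound from rare progress -/

/-- With probability at least 1/2 fewer than m events occur. The output then lies below m + e ≤ M +
1, so its last coordinate is zero and the gradient is at least (s/lam)/12. The constant is 288 = 2 ·
12². The offset e allows for coordinates that a worker finds without any event. -/
theorem le_lintegral_of_output {n M T : ℕ} (hn : n ≠ 0) {s lam : ℝ} (hs : 0 ≤ s) (hlam : 0 < lam)
    {w : Fin n → ℕ → ℝ} (hw : ∀ k, 1 / 3 ≤ (n : ℝ)⁻¹ * ∑ i, w i k)
    {O : Fin n → StochasticOracle (M + 1)} {C : WorkerCompressors n (M + 1)}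
    {Ω : Type*} [MeasurableSpace Ω] {P : Measure Ω} [IsProbabilityMeasure P]
    {A : Execution O C T 0 P} {xhat : Ω → Vec (M + 1)} (hx : A.IsOutput xhat)
    {E : ℕ → Set Ω} (hE : ∀ t ∈ Finset.Icc 1 T, MeasurableSet (E t)) {m e : ℕ} (hm : 0 < m)
    (hme : m + e ≤ M + 1) {K : ℝ} (hK : 2 * K ≤ m)
    (hsum : ∑ t ∈ Finset.Icc 1 T, P (E t) ≤ ENNReal.ofReal K)
    (hmodel : ∀ᵐ w ∂P, ∀ t ≤ T, ∀ i, SupportedBelow (occurrences E T w + e) (A.model t i w)) :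
    ENNReal.ofReal ((s / lam) ^ 2 / 288) ≤
      ∫⁻ w', ENNReal.ofReal
        (‖∇ (globalObjective fun i => scaledChain (M := M) s lam (w i)) (xhat w')‖ ^ 2) ∂P := by
  set B : Set Ω := {w | m ≤ occurrences E T w} with hB
  have hPB : P B ≤ ENNReal.ofReal (1 / 2) := by
    have h := (mul_measure_occurrences_ge_le P hE m).trans hsum
    have hm' : (0 : ℝ) < m := by exact_mod_cast hm
    have h2 : ENNReal.ofReal K ≤ (m : ENNReal) * ENNReal.ofReal (1 / 2) := by
      rw [← ENNReal.ofReal_natCast, ← ENNReal.ofReal_mul (by positivity)]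
      exact ENNReal.ofReal_le_ofReal (by linarith)
    exact (ENNReal.mul_le_mul_iff_right (by simpa using hm.ne') (by simp)).1 (h.trans h2)
  have hPB' : ENNReal.ofReal (1 / 2) ≤ P Bᶜ := by
    have h1 : 1 ≤ P B + P Bᶜ := by
      rw [← measure_univ (μ := P), ← Set.union_compl_self B]
      exact measure_union_le _ _
    have h2 : ENNReal.ofReal (1 / 2) + ENNReal.ofReal (1 / 2) = 1 := by
      rw [← ENNReal.ofReal_add (by norm_num) (by norm_num)]; norm_num
    rw [← h2] at h1
    exact (ENNReal.add_le_add_iff_left ENNReal.ofReal_ne_top).1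
      (h1.trans (add_le_add_left hPB _))
  have hgrad : ∀ᵐ w' ∂P, w' ∈ Bᶜ → ENNReal.ofReal ((s / lam / 12) ^ 2) ≤ ENNReal.ofReal
      (‖∇ (globalObjective fun i => scaledChain (M := M) s lam (w i)) (xhat w')‖ ^ 2) := by
    filter_upwards [hmodel, hx.mem_span] with w' h1 h2 h3
    have h4 : SupportedBelow (occurrences E T w' + e) (xhat w') :=
      supportedBelow_of_mem_span (by rintro v ⟨t, ht, i, rfl⟩; exact h1 t ht i) h2
    have h5 : occurrences E T w' < m := not_le.1 h3
    rw [globalObjective_scaledChain hn, gradient_scaledChain]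
    refine ENNReal.ofReal_le_ofReal (pow_le_pow_left₀ (by positivity) ?_ 2)
    exact norm_scaledGrad_ge hs hlam hw h4 (by omega)
  calc ENNReal.ofReal ((s / lam) ^ 2 / 288)
      = ENNReal.ofReal ((s / lam / 12) ^ 2) * ENNReal.ofReal (1 / 2) := by
        rw [← ENNReal.ofReal_mul (by positivity)]; congr 1; ring
    _ ≤ ENNReal.ofReal ((s / lam / 12) ^ 2) * P Bᶜ := by gcongr
    _ = ∫⁻ _ in Bᶜ, ENNReal.ofReal ((s / lam / 12) ^ 2) ∂P := by rw [setLIntegral_const]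
    _ ≤ ∫⁻ w' in Bᶜ, ENNReal.ofReal
        (‖∇ (globalObjective fun i => scaledChain (M := M) s lam (w i)) (xhat w')‖ ^ 2) ∂P := by
        refine lintegral_mono_ae ?_
        rwa [ae_restrict_iff' (measurableSet_le_occurrences hE m).compl]
    _ ≤ _ := setLIntegral_le_lintegral _ _

/-! ### The two hard instances -/

/-- There are an admissible objective, oracles and compressors for which every zero-respecting
execution ends with an expected squared gradient norm of at least `ρ`. -/
def HardInstanceExists.{u} (Δ L σ ω : ℝ) (n T : ℕ) (ρ : ℝ) : Prop :=
  ∃ (d : ℕ) (f : Fin n → Vec d → ℝ) (O : Fin n → StochasticOracle d) (C : WorkerCompressors n d),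
    0 < d ∧ InFunctionClass Δ L 0 f ∧ (∀ i, (O i).InClass (f i) σ) ∧ C.IsUnbiased ω ∧
      ∀ (Ω : Type u) [MeasurableSpace Ω] (P : Measure Ω) [IsProbabilityMeasure P]
        (A : Execution O C T 0 P), A.ZeroRespecting →
        ∀ xhat : Ω → Vec d, A.IsOutput xhat →
          ENNReal.ofReal ρ ≤ ∫⁻ w, ENNReal.ofReal (‖∇ (globalObjective f) (xhat w)‖ ^ 2) ∂P

/-- The hard instance against noisy oracles: progress along the chain needs one of the at most
`n T` coins of the oracles. -/
theorem hardInstanceExists_of_noise {Δ L σ ω s lam : ℝ} {n T M : ℕ} {p : unitInterval}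
    (hn : n ≠ 0) (hs : 0 ≤ s) (hlam : 0 < lam) (hω : 0 ≤ ω) (hp : (0 : ℝ) < p)
    (hL : 27 * s / lam ^ 2 ≤ L) (hΔ : s * (4 * (M + 1)) ≤ Δ)
    (hσ : (s / lam) ^ 2 * ((p : ℝ)⁻¹ - 1) ≤ σ ^ 2) (hM : 2 * (n * T * (p : ℝ)) ≤ (M + 1 : ℝ)) :
    HardInstanceExists Δ L σ ω n T ((s / lam) ^ 2 / 288) := by
  have hw : ∀ k : ℕ, (0 : ℝ) ≤ (fun _ => 1 : ℕ → ℝ) k := fun _ => zero_le_one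
  have hw' : ∀ k : ℕ, (fun _ => 1 : ℕ → ℝ) k ≤ 1 := fun _ => le_rfl
  have hn' : (n : ℝ) ≠ 0 := by exact_mod_cast hn
  refine ⟨M + 1, fun _ => scaledChain s lam fun _ => 1, fun _ => chainOracle p s lam hw hw',
    coinCompressors n (M + 1) 1, by omega,
    inFunctionClass_scaledChain hn hs hlam (fun _ => hw) (fun _ => hw') hL hΔ,
    fun _ => inClass_chainOracle hp hw hw' hσ,
    isUnbiased_coinCompressors n (M + 1) (by simp) (by simpa using hω), ?_⟩
  intro Ω _ P _ A hA xhat hx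
  -- An iteration counts once however many coins fall true: all its queries start from the same
  -- level and each answer gains at most one coordinate.
  set E : ℕ → Set Ω := fun t => ⋃ i : Fin n, {w | A.oracleSeed t w i ∈ ({true} : Set Bool)}
   
  have hE : ∀ t ∈ Finset.Icc 1 T, MeasurableSet (E t) := fun t ht =>
    MeasurableSet.iUnion fun i => A.measurableSet_oracleSeed ht i (measurableSet_singleton true)
  refine le_lintegral_of_output (m := M + 1) (e := 0) (K := n * T * p) hn hs hlam (fun k => ?_) hx
    hE (by omega) (by omega) (by exact_mod_cast hM) ?_ ?_
  · simp [hn']; norm_num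
  · calc ∑ t ∈ Finset.Icc 1 T, P (E t)
        ≤ ∑ t ∈ Finset.Icc 1 T, ∑ _i : Fin n, ENNReal.ofReal p := by
          refine Finset.sum_le_sum fun t ht => (measure_iUnion_fintype_le _ _).trans ?_
          refine Finset.sum_le_sum fun i _ => ?_
          exact ((A.measure_oracleSeed ht i (measurableSet_singleton true)).trans
            (coin_true p)).le
      _ = ENNReal.ofReal (n * T * p) := by
          simp only [Finset.sum_const, Finset.card_univ, Fintype.card_fin, Nat.card_Icc,
            nsmul_eq_mul, Nat.add_sub_cancel]
          rw [ENNReal.ofReal_mul (by positivity), ENNReal.ofReal_mul (by positivity),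
            ENNReal.ofReal_natCast, ENNReal.ofReal_natCast]
          ring
  · filter_upwards [hA.query, hA.model, hA.message, hA.broadcast] with w h1 h2 h3 h4
    have hmono := monotone_occurrences E w
    intro t ht i
    -- Compression plays no role here, so one level serves the server and all workers; it rises
    -- already with the answers of the iteration.
    refine (A.supportedBelow_model (Nat.pos_of_ne_zero hn) h1 h2 h3 h4
      (server := fun t => occurrences E t w) (worker := fun t _ => occurrences E t w)
      (mid := fun t _ => occurrences E t w) hmono (fun _ => hmono) (fun _ _ => le_rfl)
      (fun t _ => hmono (Nat.le_succ t)) (fun _ _ => le_rfl) ?_ ?_ t ht i).mono (hmono ht)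
    · intro t _ i hq
      by_cases hmem : w ∈ E (t + 1)
      · rw [occurrences_succ_of_mem hmem]
        exact supportedBelow_chainOracle_eval p s lam hw hw' _ (hq.scaledGrad _ _ _)
      · rw [occurrences_succ_of_notMem hmem]
        have hz : A.oracleSeed (t + 1) w i = false :=
          Bool.eq_false_of_not_eq_true fun h => hmem (Set.mem_iUnion.2 ⟨i, h⟩)
        rw [Execution.answer, hz]
        exact supportedBelow_chainOracle_eval_false p s lam hw hw' hq
    · intro t _ i j _ hmsg
      exact hmsg.smul _

/-- Workers of each parity hold the links of that parity. -/
def parityWeight (i k : ℕ) : ℝ := if k % 2 = i % 2 then 1 else 0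

theorem le_two_mul_sum_parityWeight_add_one (k n : ℕ) :
    (n : ℝ) ≤ 2 * ∑ i ∈ Finset.range n, parityWeight i k + 1 := by
  induction n using Nat.twoStepInduction with
  | zero => simp
  | one =>
    rw [Finset.sum_range_one, parityWeight]
    split_ifs <;> norm_num
  | more n ih _ =>
    rw [Finset.sum_range_succ, Finset.sum_range_succ]
    have h : parityWeight n k + parityWeight (n + 1) k = 1 := by
      unfold parityWeight
      rcases Nat.mod_two_eq_zero_or_one k with h | h <;>
        rcases Nat.mod_two_eq_zero_or_one n with h' | h' <;> simp [h, h', Nat.add_mod]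
    push_cast
    linarith

theorem third_le_mean_parityWeight (k : ℕ) {n : ℕ} (hn : 2 ≤ n) :
    1 / 3 ≤ (n : ℝ)⁻¹ * ∑ i : Fin n, parityWeight i k := by
  have hn' : (0 : ℝ) < n := by exact_mod_cast (by omega : 0 < n)
  rw [Fin.sum_univ_eq_sum_range (fun i => parityWeight i k) n]
  have h := le_two_mul_sum_parityWeight_add_one k n
  obtain ⟨c, hc⟩ : ∃ c : ℕ, ∑ i ∈ Finset.range n, parityWeight i k = c := by
    unfold parityWeight
    rw [Finset.sum_boole]
    exact ⟨_, rfl⟩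
  rw [hc] at h ⊢
  have h1 : n ≤ 2 * c + 1 := by exact_mod_cast h
  -- As n ≥ 2 forces c ≥ 1, n ≤ 2c + 1 ≤ 3c, with equality for n = 3 and the minority parity.
  have h2 : (n : ℝ) ≤ 3 * c := by exact_mod_cast (by omega : n ≤ 3 * c)
  rw [inv_mul_eq_div, div_le_div_iff₀ (by norm_num) hn']
  linarith

/-- How far worker `i` gets by itself once the server has passed on the first `m` coordinates. -/
def parityLevel (m i : ℕ) : ℕ := if m % 2 = i % 2 then m + 1 else m

theorem le_parityLevel (m i : ℕ) : m ≤ parityLevel m i := by unfold parityLevel; split_ifs <;> omega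

theorem parityLevel_le (m i : ℕ) : parityLevel m i ≤ m + 1 := by
  unfold parityLevel; split_ifs <;> omega

theorem monotone_parityLevel (i : ℕ) : Monotone fun m => parityLevel m i :=
  monotone_nat_of_le_succ fun m => (parityLevel_le m i).trans (le_parityLevel (m + 1) i)

/-- The level of a worker always stops at a link of the other parity, so its own oracle cannot take
it further. -/
theorem parityWeight_parityLevel (m i : ℕ) : parityWeight i (parityLevel m i) = 0 := by
  unfold parityWeight parityLevel
  split_ifs <;> first | rfl | omega

/-- The hard instance against compression: progress along the chain needs a round of communication
in which the common coin of the compressors lets the messages pass. -/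
theorem hardInstanceExists_of_compression {Δ L σ ω s lam : ℝ} {n T M : ℕ} {q : unitInterval}
    (hn : 2 ≤ n) (hs : 0 ≤ s) (hlam : 0 < lam) (hq : (0 : ℝ) < q) (hω : (q : ℝ)⁻¹ - 1 ≤ ω)
    (hL : 27 * s / lam ^ 2 ≤ L) (hΔ : s * (4 * (M + 1)) ≤ Δ) (hM0 : 0 < M)
    (hM : 2 * ((q : ℝ) * T) ≤ (M : ℝ)) :
    HardInstanceExists Δ L σ ω n T ((s / lam) ^ 2 / 288) := by
  have hw : ∀ i k : ℕ, 0 ≤ parityWeight i k := fun i k => by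
    unfold parityWeight; split_ifs <;> norm_num
  have hw' : ∀ i k : ℕ, parityWeight i k ≤ 1 := fun i k => by
    unfold parityWeight; split_ifs <;> norm_num
  have hn0 : n ≠ 0 := by omega
  refine ⟨M + 1, fun i => scaledChain s lam (parityWeight i),
    fun i => chainOracle 1 s lam (hw i) (hw' i), coinCompressors n (M + 1) q, by omega,
    inFunctionClass_scaledChain hn0 hs hlam (fun i => hw i) (fun i => hw' i) hL hΔ,
    fun i => inClass_chainOracle (by simp) (hw i) (hw' i) (by simpa using sq_nonneg σ),
    isUnbiased_coinCompressors n (M + 1) hq hω, ?_⟩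
  intro Ω _ P _ A hA xhat hx
  -- Because the coin is shared by the workers, the union runs over rounds only and no factor n
  -- appears.
  set E : ℕ → Set Ω := fun t => ⋃ j : Fin T, {w | (j : ℕ) < A.rounds t w} ∩
    {w | A.roundSeed t w j ∈ ({true} : Set Bool)}
  have hE : ∀ t ∈ Finset.Icc 1 T, MeasurableSet (E t) := fun t ht =>
    MeasurableSet.iUnion fun j =>
      (A.between_le_ambient t _ (A.measurableSet_lt_rounds ht j)).inter
        (A.measurableSet_roundSeed ht j (measurableSet_singleton true))
  refine le_lintegral_of_output (m := M) (e := 1) (K := q * T) hn0 hs hlam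
    (fun k => third_le_mean_parityWeight k hn) hx hE hM0 le_rfl hM ?_ ?_
  · calc ∑ t ∈ Finset.Icc 1 T, P (E t)
        ≤ ∑ t ∈ Finset.Icc 1 T, ∑ j : Fin T,
            P {w | (j : ℕ) < A.rounds t w} * ENNReal.ofReal q := by
          refine Finset.sum_le_sum fun t ht => (measure_iUnion_fintype_le _ _).trans ?_
          refine Finset.sum_le_sum fun j _ => ?_
          exact ((A.measure_lt_rounds_inter_roundSeed ht j (measurableSet_singleton true)).trans
            (congrArg _ (coin_true q))).le
      _ = (∑ t ∈ Finset.Icc 1 T, ∑ j : Fin T, P {w | (j : ℕ) < A.rounds t w}) *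
            ENNReal.ofReal q := by
          simp only [Finset.sum_mul]
      _ ≤ T * ENNReal.ofReal q := by gcongr; exact A.sum_measure_lt_rounds_le
      _ = ENNReal.ofReal (q * T) := by
          rw [ENNReal.ofReal_mul hq.le, ENNReal.ofReal_natCast, mul_comm]
  · filter_upwards [hA.query, hA.model, hA.message, hA.broadcast] with w h1 h2 h3 h4
    have hmono := monotone_occurrences E w
    intro t ht i
    -- Messages of iteration t use only broadcasts of earlier iterations, hence the level t - 1 in
    -- `mid`; several successful rounds in one iteration still gain one coordinate. At t = 0 the
    -- truncated subtraction is harmless.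
    refine (A.supportedBelow_model (by omega) h1 h2 h3 h4
      (server := fun t => occurrences E t w)
      (worker := fun t i => parityLevel (occurrences E t w) i)
      (mid := fun t i => parityLevel (occurrences E (t - 1) w) i) hmono
      (fun i => (monotone_parityLevel i).comp hmono)
      (fun t i => monotone_parityLevel i (hmono (Nat.sub_le t 1)))
      (fun t _ => le_rfl) (fun _ _ => le_parityLevel _ _) ?_ ?_ t ht i).mono
      ((parityLevel_le _ _).trans (Nat.succ_le_succ (hmono ht)))
    · intro t _ i hq'
      exact supportedBelow_chainOracle_eval 1 s lam (hw i) (hw' i) _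
        (hq'.scaledGrad_of_weight_eq_zero _ _ (parityWeight_parityLevel _ _))
    · intro t _ i j hj hmsg
      by_cases hmem : w ∈ E (t + 1)
      · rw [occurrences_succ_of_mem hmem]
        exact (hmsg.mono (parityLevel_le _ _)).smul _
      · have hz : A.roundSeed (t + 1) w j = false :=
          Bool.eq_false_of_not_eq_true fun h => hmem (Set.mem_iUnion.2 ⟨j, hj, h⟩)
        have h0 : A.received (t + 1) i j w = 0 := by
          rw [Execution.received, hz]
          simp [coinCompressors, coinFactor]
        rw [h0]
        exact SupportedBelow.zero

/-! ### The choice of the parameters -/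

/-- Both constraints are met with equality: s = Δ/(4(M + 1)) and lam² = 27s/L. -/
theorem exists_chain_scale {Δ L : ℝ} (hΔ : 0 < Δ) (hL : 0 < L) (M : ℕ) :
    ∃ s lam : ℝ, 0 ≤ s ∧ 0 < lam ∧ 27 * s / lam ^ 2 ≤ L ∧ s * (4 * (M + 1)) ≤ Δ ∧
      (s / lam) ^ 2 = Δ * L / (108 * (M + 1)) := by
  have hM : (0 : ℝ) < M + 1 := by positivity
  have h : Real.sqrt (27 * Δ / (4 * (M + 1) * L)) ^ 2 = 27 * Δ / (4 * (M + 1) * L) :=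
    Real.sq_sqrt (by positivity)
  refine ⟨Δ / (4 * (M + 1)), Real.sqrt (27 * Δ / (4 * (M + 1) * L)), by positivity,
    Real.sqrt_pos.2 (by positivity), ?_, ?_, ?_⟩
  · rw [h]; apply le_of_eq; field_simp
  · apply le_of_eq; field_simp
  · rw [div_pow, h]; field_simp; norm_num

theorem hardInstanceExists_noise {Δ L σ ω : ℝ} {n T : ℕ} (hΔ : 0 < Δ) (hL : 0 < L) (hn : 2 ≤ n)
    (hω : 0 ≤ ω) (hσ : 0 < σ) (hT : 0 < T) :
    HardInstanceExists Δ L σ ω n T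
      (min (Δ * L) (Real.sqrt (Δ * L * σ ^ 2 / (n * T))) / 93312) := by
  have hn' : (0 : ℝ) < n := by exact_mod_cast (by omega : 0 < n)
  have hT' : (0 : ℝ) < T := by exact_mod_cast hT
  set a : ℝ := n * T * (Δ * L) / σ ^ 2 with ha
  have ha0 : 0 < a := by positivity
  -- With p ≤ r/σ² the requirement on M reads a/(54(M + 1)) ≤ M + 1, hence M of order √a.
  set M : ℕ := ⌈Real.sqrt a⌉₊ with hM
  have hM1 : Real.sqrt a ≤ M := Nat.le_ceil _
  have hM2 : (M : ℝ) < Real.sqrt a + 1 := Nat.ceil_lt_add_one (Real.sqrt_nonneg _)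
  have hsq : Real.sqrt a ^ 2 = a := Real.sq_sqrt ha0.le
  have hsa : 0 < Real.sqrt a := Real.sqrt_pos.2 ha0
  obtain ⟨s, lam, hs, hlam, hsL, hsΔ, hr⟩ := exists_chain_scale hΔ hL M
  set r : ℝ := Δ * L / (108 * (M + 1)) with hrdef
  have hr0 : 0 < r := by positivity
  -- For p = r/σ² the variance r(1/p - 1) is σ² - r; if r ≥ σ², then p = 1 and there is no noise.
  let p : unitInterval := ⟨min 1 (r / σ ^ 2), by positivity, min_le_left _ _⟩
  have hp : (0 : ℝ) < p := lt_min one_pos (by positivity)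
  -- M + 1 ≤ 3 max(1, √a), and 93312 = 288 · 108 · 3. The case √a ≤ 1 produces the term ΔL of the
  -- minimum.
  have hb : min (Δ * L) (Real.sqrt (Δ * L * σ ^ 2 / (n * T))) / 93312 ≤ (s / lam) ^ 2 / 288 := by
    have e : Real.sqrt (Δ * L * σ ^ 2 / (n * T)) = Δ * L / Real.sqrt a := by
      rw [show Δ * L * σ ^ 2 / (n * T) = (Δ * L) ^ 2 / a by rw [ha]; field_simp,
        Real.sqrt_div (by positivity), Real.sqrt_sq (by positivity)]
    rw [e, hr, hrdef, div_div, div_le_div_iff₀ (by norm_num) (by positivity)]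
    rcases le_total (Real.sqrt a) 1 with h | h
    · have := min_le_left (Δ * L) (Δ * L / Real.sqrt a)
      have hx : (M + 1 : ℝ) ≤ 3 := by linarith
      nlinarith [mul_pos hΔ hL]
    · have h1 := min_le_right (Δ * L) (Δ * L / Real.sqrt a)
      have hx : (M + 1 : ℝ) ≤ 3 * Real.sqrt a := by linarith
      calc min (Δ * L) (Δ * L / Real.sqrt a) * (108 * (M + 1) * 288)
          ≤ Δ * L / Real.sqrt a * (108 * (3 * Real.sqrt a) * 288) := by gcongr
        _ = Δ * L * 93312 := by field_simp; norm_num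
  obtain ⟨d, f, O, C, h1, h2, h3, h4, h5⟩ := hardInstanceExists_of_noise (Δ := Δ) (L := L) (σ := σ)
    (n := n) (T := T) (M := M) (p := p) (by omega) hs hlam hω hp hsL hsΔ (by
      rw [hr]
      rcases le_total 1 (r / σ ^ 2) with h | h
      · have : (p : ℝ) = 1 := min_eq_left h
        rw [this]; simp; positivity
      · have : (p : ℝ) = r / σ ^ 2 := min_eq_right h
        rw [this, mul_sub, inv_div, mul_div_cancel₀ _ hr0.ne']
        linarith) (by
      have h : (p : ℝ) ≤ r / σ ^ 2 := min_le_right _ _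
      calc 2 * (n * T * (p : ℝ)) ≤ 2 * (n * T * (r / σ ^ 2)) := by gcongr
        _ = a / (54 * (M + 1)) := by rw [ha, hrdef]; field_simp; norm_num
        _ ≤ M + 1 := by
          rw [div_le_iff₀ (by positivity)]
          nlinarith)
  exact ⟨d, f, O, C, h1, h2, h3, h4, fun Ω _ P _ A hA xhat hx =>
    (ENNReal.ofReal_le_ofReal hb).trans (h5 Ω P A hA xhat hx)⟩

theorem hardInstanceExists_compression {Δ L σ ω : ℝ} {n T : ℕ} (hΔ : 0 < Δ) (hL : 0 < L)
    (hn : 2 ≤ n) (hω : 0 ≤ ω) (hT : 1 + ω ≤ T) :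
    HardInstanceExists Δ L σ ω n T ((1 + ω) * Δ * L / T / 124416) := by
  have hω' : 0 < 1 + ω := by linarith
  have hT' : (0 : ℝ) < T := by linarith
  let q : unitInterval := ⟨(1 + ω)⁻¹, by positivity, inv_le_one_of_one_le₀ (by linarith)⟩
  have hq : (q : ℝ) = (1 + ω)⁻¹ := rfl
  have hqT : 1 ≤ (T : ℝ) / (1 + ω) := (one_le_div hω').2 hT
  set M : ℕ := ⌈2 * (T / (1 + ω))⌉₊ with hM
  have hM1 : 2 * (T / (1 + ω)) ≤ M := Nat.le_ceil _
  have hM2 : (M : ℝ) < 2 * (T / (1 + ω)) + 1 := Nat.ceil_lt_add_one (by positivity)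
  obtain ⟨s, lam, hs, hlam, hsL, hsΔ, hr⟩ := exists_chain_scale hΔ hL M
  have hb : (1 + ω) * Δ * L / T / 124416 ≤ (s / lam) ^ 2 / 288 := by
    rw [hr, div_div, div_div, div_le_div_iff₀ (by positivity) (by positivity)]
    -- This uses T/(1 + ω) ≥ 1 to absorb the rounding; 124416 = 288 · 108 · 4.
    have h1 : (M + 1 : ℝ) ≤ 4 * (T / (1 + ω)) := by linarith
    calc (1 + ω) * Δ * L * (108 * (M + 1) * 288)
        ≤ (1 + ω) * Δ * L * (108 * (4 * (T / (1 + ω))) * 288) := by gcongr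
      _ = Δ * L * (T * 124416) := by field_simp; norm_num
  obtain ⟨d, f, O, C, h1, h2, h3, h4, h5⟩ := hardInstanceExists_of_compression (Δ := Δ) (L := L)
    (σ := σ) (ω := ω) (n := n) (T := T) (M := M) (q := q) hn hs hlam (by rw [hq]; positivity)
    (by rw [hq, inv_inv]; linarith) hsL hsΔ (Nat.ceil_pos.2 (by positivity))
    (by rw [hq, inv_mul_eq_div]; exact hM1)
  exact ⟨d, f, O, C, h1, h2, h3, h4, fun Ω _ P _ A hA xhat hx =>
    (ENNReal.ofReal_le_ofReal hb).trans (h5 Ω P A hA xhat hx)⟩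

theorem theorem1 :
    ∃ c : ℝ, 0 < c ∧
      ∀ (Δ L σ ω : ℝ) (n T : ℕ), 0 < Δ → 0 < L → 2 ≤ n → 0 ≤ ω → 0 < σ → (1 + ω) ^ 2 ≤ (T : ℝ) →
        ∃ (d : ℕ) (f : Fin n → Vec d → ℝ) (O : Fin n → StochasticOracle d)
          (C : WorkerCompressors n d),
          0 < d ∧ InFunctionClass Δ L 0 f ∧ (∀ i, (O i).InClass (f i) σ) ∧ C.IsUnbiased ω ∧
            ∀ (Ω : Type*) [MeasurableSpace Ω] (P : Measure Ω) [IsProbabilityMeasure P]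
              (A : Execution O C T 0 P), A.ZeroRespecting →
              ∀ xhat : Ω → Vec d, A.IsOutput xhat →
                ENNReal.ofReal (c * (min (Δ * L) (Real.sqrt (Δ * L * σ ^ 2 / (n * T))) +
                    (1 + ω) * Δ * L / T)) ≤
                  ∫⁻ w, ENNReal.ofReal (‖∇ (globalObjective f) (xhat w)‖ ^ 2) ∂P := by
  -- Half of the smaller of the two constants 1/93312 and 1/124416.
  refine ⟨1 / 248832, by norm_num, fun Δ L σ ω n T hΔ hL hn hω hσ hT => ?_⟩
  have hT1 : 1 + ω ≤ T := le_trans (by nlinarith) hT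
  have hT0 : 0 < T := by
    have : (0 : ℝ) < T := by linarith
    exact_mod_cast this
  have ha : 0 ≤ min (Δ * L) (Real.sqrt (Δ * L * σ ^ 2 / (n * T))) :=
    le_min (by positivity) (Real.sqrt_nonneg _)
  rcases le_total (min (Δ * L) (Real.sqrt (Δ * L * σ ^ 2 / (n * T)))) ((1 + ω) * Δ * L / T)
    with h | h
  · obtain ⟨d, f, O, C, h1, h2, h3, h4, h5⟩ :=
      hardInstanceExists_compression (σ := σ) hΔ hL hn hω hT1
    exact ⟨d, f, O, C, h1, h2, h3, h4, fun Ω _ P _ A hA xhat hx =>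
      (ENNReal.ofReal_le_ofReal (by linarith)).trans (h5 Ω P A hA xhat hx)⟩
  · obtain ⟨d, f, O, C, h1, h2, h3, h4, h5⟩ :=
      hardInstanceExists_noise (ω := ω) hΔ hL hn hω hσ hT0
    exact ⟨d, f, O, C, h1, h2, h3, h4, fun Ω _ P _ A hA xhat hx =>
      (ENNReal.ofReal_le_ofReal (by linarith)).trans (h5 Ω P A hA xhat hx)⟩
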